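/- **Definitions.** A cone in $\mathbb R^2$ is a set $\{u: |u\cdot v|\ge \ell\|u\|\}$ with $\|v\|=1$, $\ell\in(0,1)$; its axis is $\mathbb R v$. Two cones form a universal pair $(K^u,K^s)$ if $K^u\cap K^s=\{0\}$, the axis of $K^u$ is the $x$-axis and the axis of $K^s$ is the $y$-axis. A cone field assigns to each $P\in\mathbb R^2$ a cone whose axis vector and coefficient $\ell$ depend continuously on $P$. Two $C^1$ diffeomorphisms $F_1,F_2$ of $\mathbb R^2$ are *synchronously hyperbolic* if both preserve or both reverse orientation and there are $\lambda>1$ (the stretching factor), a universal pair $K^u,K^s$, and cone fields $(K^u_P)$, $(K^s_P)$ such that for $i=1,2$ and all $P$: - (S1) $K^u_P\subset K^u$, $K^s_P\subset K^s$, $(DF_i)_P(K^u_P)\subset K^u_{F_i(P)}$ and $(DF_i^{-1})_P(K^s_P)\subset K^s_{F_i^{-1}(P)}$; - (S2) $\|(DF_i)_P u\|\ge\lambda\|u\|$ for $u\in K^u_P$ and $\|(DF_i^{-1})_P w\|\ge\lambda\|w\|$ for $w\in K^s_P$; - (S3) there is a $C^1$ curve $\Gamma=\{(f(y),y):y\in\mathbb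 R\}$ (the divider) on which $F_1=F_2$, whose tangent vector at each $P\in\Gamma$ lies in $K^s_P$, and such that the vector tangent to $F_i(\Gamma)$ at $F_i(P)$ lies in $K^u_{F_i(P)}$. The sets $\{x\le f(y)\}$ and $\{x\ge f(y)\}$ are the left and right half-planes. A map $F$ that equals $F_1$ on the left and $F_2$ on the right half-plane is *Lozi-like* if - (L1) $-1<\det (DF_i)_P<0$ for all $P$ and $i=1,2$; - (L2) there is a nonempty set $\Delta$, homeomorphic to an open disk and with closure homeomorphic to a closed disk, such that $F(\overline\Delta)\subset\operatorname{Int}\Delta$. Let $X$ be the unique fixed point of $F$ in $\Delta$, assumed to lie in the right half-plane, and let $W^u_G(X)$, $W^s_G(X)$ denote the (global) unstable and stable manifolds of a map $G$ at $X$. Let $D$ and $M$ be the unique points of $\Gamma\cap W^u_{F_2}(X)$ and $\Gamma\cap W^s_{F_2}(X)$, respectively. Consider the conditions - (L3) the arc of $W^u_F(X)$ with endpoints $F^3(D)$ and $F(D)$ intersects the arc of $W^s_F(X)$ with endpoints $X$ and $M$; - (L4) $\lambda>\sqrt2$. **Statement.** Let $a,b,c\in\mathbb R$ satisfy - (A1)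 $0<b<1$, $c\ge0$; - (A2) $(2a+b)\left(1-\frac{c^2}{(a+b)^2}\right)<4$; - (A3) $(a-c)\sqrt2>b+2$. Then the map $F_{a,b,c}(x,y)=(1+y-a|x|-cx,\;bx)$ is Lozi-like, with $F_1(x,y)=(1+y+(a-c)x,\,bx)$, $F_2(x,y)=(1+y-(a+c)x,\,bx)$ and with the $y$-axis as the divider $\Gamma$. Moreover, for a suitable choice of the data in these definitions (stretching factor $\lambda$, cones, cone fields, and $\Delta$), the point $X$ is well defined and lies in the right half-plane, $D$ and $M$ are well defined, and (L3) and (L4) hold. -/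

import Mathlib

open Set Filter Topology

noncomputable section

/-- The Euclidean plane `ℝ²`. -/
abbrev Plane : Type := EuclideanSpace ℝ (Fin 2)

/-- `C¹` diffeomorphisms of the plane onto itself. -/
abbrev PlaneDiffeo : Type :=
  Diffeomorph (modelWithCornersSelf ℝ Plane) (modelWithCornersSelf ℝ Plane) Plane Plane 1

/-- The data of a cone: a unit vector `v` and a number `ℓ ∈ (0, 1)`. -/
structure Cone where
  v : Plane
  ℓ : ℝ
  norm_v : ‖v‖ = 1
  ℓ_pos : 0 < ℓ
  ℓ_lt_one : ℓ < 1

namespace Cone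

/-- The cone as a set of vectors: `{u : |u · v| ≥ ℓ ‖u‖}`. -/
def carrier (K : Cone) : Set Plane := {u | K.ℓ * ‖u‖ ≤ |inner ℝ u K.v|}

/-- The axis `{t v : t ∈ ℝ}`. -/
def axis (K : Cone) : Set Plane := {w | ∃ t : ℝ, w = t • K.v}

/-- Two cones are disjoint if they have only the zero vector in common. -/
def IsDisjoint (K L : Cone) : Prop := K.carrier ∩ L.carrier = {0}

/-- A universal pair of cones: disjoint, the axis of the first is the `x`-axis and the axis of
the second is the `y`-axis. -/
def IsUniversalPair (Ku Ks : Cone) : Prop :=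
  IsDisjoint Ku Ks ∧ Ku.axis = {w | w 1 = 0} ∧ Ks.axis = {w | w 0 = 0}

end Cone

/-- A cone field on the plane: a cone at every point, with the axis vector and the coefficient
depending continuously on the point. -/
structure ConeField where
  cone : Plane → Cone
  continuous_v : Continuous fun P => (cone P).v
  continuous_ℓ : Continuous fun P => (cone P).ℓ

/-- `G` preserves orientation. -/
def OrientationPreserving (G : PlaneDiffeo) : Prop := ∀ P, 0 < (fderiv ℝ G P).det

/-- `G` reverses orientation. -/
def OrientationReversing (G : PlaneDiffeo) : Prop := ∀ P, (fderiv ℝ G P).det < 0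

/-- The unstable cone field `Cu` is invariant under `DG` and the stable cone field `Cs` is
invariant under `D(G⁻¹)`. -/
def ConesInvariant (G : PlaneDiffeo) (Cu Cs : ConeField) : Prop :=
  (∀ P, (fderiv ℝ G P) '' (Cu.cone P).carrier ⊆ (Cu.cone (G P)).carrier) ∧
  (∀ P, (fderiv ℝ G.symm P) '' (Cs.cone P).carrier ⊆ (Cs.cone (G.symm P)).carrier)

/-- `DG` stretches the unstable cones, and `D(G⁻¹)` stretches the stable cones, by the factor
at least `s` in the Euclidean norm. -/
def ConesStretched (G : PlaneDiffeo) (Cu Cs : ConeField) (s : ℝ) : Prop :=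
  (∀ P, ∀ u ∈ (Cu.cone P).carrier, s * ‖u‖ ≤ ‖fderiv ℝ G P u‖) ∧
  (∀ P, ∀ w ∈ (Cs.cone P).carrier, s * ‖w‖ ≤ ‖fderiv ℝ G.symm P w‖)

/-- Synchronous hyperbolicity of the pair `F₁, F₂`, with all of its data: the stretching factor,
the universal pair of cones, the two cone fields, and the divider `Γ`.

A smooth curve that is infinite in both directions and whose tangent vectors lie in cones around
the `y`-axis is the graph `x = f y` of a `C¹` function `f` defined on all of `ℝ`; `f` is the field
`divider`, and the tangent vector of `Γ` at `(f y, y)` is `(f' y, 1)`. -/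
structure SynchronouslyHyperbolic (F₁ F₂ : PlaneDiffeo) where
  /-- the stretching factor `λ` -/
  stretch : ℝ
  one_lt_stretch : 1 < stretch
  Ku : Cone
  Ks : Cone
  universal : Cone.IsUniversalPair Ku Ks
  Cu : ConeField
  Cs : ConeField
  orientation : (OrientationPreserving F₁ ∧ OrientationPreserving F₂) ∨
    (OrientationReversing F₁ ∧ OrientationReversing F₂)
  Cu_subset : ∀ P, (Cu.cone P).carrier ⊆ Ku.carrier
  Cs_subset : ∀ P, (Cs.cone P).carrier ⊆ Ks.carrier
  invariant₁ : ConesInvariant F₁ Cu Cs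
  invariant₂ : ConesInvariant F₂ Cu Cs
  stretched₁ : ConesStretched F₁ Cu Cs stretch
  stretched₂ : ConesStretched F₂ Cu Cs stretch
  divider : ℝ → ℝ
  divider_smooth : ContDiff ℝ 1 divider
  agree : ∀ y, F₁ !₂[divider y, y] = F₂ !₂[divider y, y]
  tangent_mem : ∀ y, !₂[deriv divider y, 1] ∈ (Cs.cone !₂[divider y, y]).carrier
  image_tangent_mem₁ : ∀ y, fderiv ℝ F₁ !₂[divider y, y] !₂[deriv divider y, 1] ∈
    (Cu.cone (F₁ !₂[divider y, y])).carrier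
  image_tangent_mem₂ : ∀ y, fderiv ℝ F₂ !₂[divider y, y] !₂[deriv divider y, 1] ∈
    (Cu.cone (F₂ !₂[divider y, y])).carrier

namespace SynchronouslyHyperbolic

variable {F₁ F₂ : PlaneDiffeo}

/-- The divider as a curve in the plane. -/
def Γ (S : SynchronouslyHyperbolic F₁ F₂) : Set Plane := {P | P 0 = S.divider (P 1)}

/-- The left half-plane, with its boundary `Γ`. -/
def leftHalf (S : SynchronouslyHyperbolic F₁ F₂) : Set Plane := {P | P 0 ≤ S.divider (P 1)}

/-- The right half-plane, with its boundary `Γ`. -/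
def rightHalf (S : SynchronouslyHyperbolic F₁ F₂) : Set Plane := {P | S.divider (P 1) ≤ P 0}

end SynchronouslyHyperbolic

/-- A trapping region of `F`: a nonempty set that is mapped with its closure into its interior. -/
def IsTrappingRegion (F : Plane → Plane) (U : Set Plane) : Prop :=
  U.Nonempty ∧ F '' closure U ⊆ interior U

/-- A Lozi-like structure on a map `F` of the plane: synchronously hyperbolic `C¹`
diffeomorphisms `F₁, F₂` from which `F` is glued along the divider, with determinants in
`(-1, 0)`, and a disk-like trapping region `Δ`. -/
structure LoziLike (F : Plane → Plane) where
  F₁ : PlaneDiffeo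
  F₂ : PlaneDiffeo
  sync : SynchronouslyHyperbolic F₁ F₂
  eq_left : ∀ P ∈ sync.leftHalf, F P = F₁ P
  eq_right : ∀ P ∈ sync.rightHalf, F P = F₂ P
  det₁ : ∀ P, (fderiv ℝ F₁ P).det ∈ Ioo (-1 : ℝ) 0
  det₂ : ∀ P, (fderiv ℝ F₂ P).det ∈ Ioo (-1 : ℝ) 0
  Δ : Set Plane
  trapping : IsTrappingRegion F Δ
  open_disk : Nonempty (Δ ≃ₜ Metric.ball (0 : Plane) 1)
  closed_disk : Nonempty (closure Δ ≃ₜ Metric.closedBall (0 : Plane) 1)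

/-- The (global) stable manifold of `G` at the fixed point `X`. -/
def stableManifold (G : Plane → Plane) (X : Plane) : Set Plane :=
  {P | Tendsto (fun n : ℕ => G^[n] P) atTop (𝓝 X)}

/-- The (global) unstable manifold of `G` at the fixed point `X`: the points whose backward
orbit converges to `X`. For a bijective `G` the backward orbit of a point is unique. -/
def unstableManifold (G : Plane → Plane) (X : Plane) : Set Plane :=
  {P | ∃ p : ℕ → Plane, p 0 = P ∧ (∀ n, G (p (n + 1)) = p n) ∧ Tendsto p atTop (𝓝 X)}

/-- `A` is an arc with endpoints `P` and `Q`. -/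
def IsArc (P Q : Plane) (A : Set Plane) : Prop :=
  ∃ γ : Path P Q, Function.Injective γ ∧ range γ = A

namespace LoziLike

variable {F : Plane → Plane}

/-- The condition on the position of `F³(D)`: `X` is the unique fixed point of `F` in `Δ`, and it lies in the right
half-plane; `D` (resp. `M`) is the unique point in which the unstable (resp. stable) manifold of
`F₂` at `X` meets the divider. The arc `[F³(D), F(D)]` of the unstable manifold of `F` at `X`
intersects the arc `[X, M]` of the stable manifold of `F` at `X`. -/
def L3 (S : LoziLike F) : Prop :=
  ∃ X D M : Plane,
    {P | P ∈ S.Δ ∧ F P = P} = {X} ∧ X ∈ S.sync.rightHalf ∧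
    unstableManifold S.F₂ X ∩ S.sync.Γ = {D} ∧
    stableManifold S.F₂ X ∩ S.sync.Γ = {M} ∧
    ∃ A B : Set Plane,
      IsArc (F (F (F D))) (F D) A ∧ A ⊆ unstableManifold F X ∧
      IsArc X M B ∧ B ⊆ stableManifold F X ∧
      (A ∩ B).Nonempty

/-- The condition that the stretching factor is larger than `√2`. -/
def L4 (S : LoziLike F) : Prop := √2 < S.sync.stretch

end LoziLike

/-- The three-parameter family `F_{a,b,c}(x, y) = (1 + y - a|x| - c x, b x)`. -/
def loziFamily (a b c : ℝ) (P : Plane) : Plane :=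
  !₂[1 + P 1 - a * |P 0| - c * P 0, b * P 0]

end

/-!
On either side of the `y`-axis the map is affine, with Jacobian matrix `!![p, 1; b, 0]` on the left
and `!![-q, 1; b, 0]` on the right, where `p = a - c` and `q = a + c`. So everything reduces to
linear algebra and to a few inequalities between the eigenvalues `κ₁, -ν₁` of the first and
`-κ₂, ν₂` of the second matrix (`LoziSpectrum`).

*Hyperbolicity.* The constant cone fields `{|y| ≤ (b / √2) |x|}` and `{|x| ≤ |y| / √2}` serve both
branches. Invariance and stretching by more than `√2` both come down to `p - b / √2 > √2`, which is
the hypothesis `(a - c) √2 > b + 2` (`conesInvariant_henonBranch`, `conesStretched_henonBranch`,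
`exists_stretch_gt_sqrt_two`).

*Trapping region.* The second hypothesis on the parameters is equivalent to `κ₁ κ₂ < p + q + b`
(`mul_lt_of_quadratic`), which says that `F²(D)` lies on the right of the stable line of the fixed
point of the left branch. Therefore `F` maps a triangle into its interior
(`loziFamily_mem_openTriangle`): its upper side is slightly above the unstable line of `X`, its
lower side slightly below the line through `F(D)` and `F³(D)`, and its left side slightly to the
right of the stable line of the left fixed point. A bounded convex open set is a disk.

*Arcs.* The stable and unstable manifolds of the right branch at `X` are its two eigenlines, because
the coordinate along the other eigenvector is multiplied by a number of modulus less (resp. greater)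
than one in each step. The points from `D` to `F²(D)` on the unstable line have all their
preimages in the right half-plane, so the image of this segment under the left branch, the segment
from `F(D)` to `F³(D)`, belongs to the unstable manifold of `F`. It meets the stable line in a point
that can be computed; that this point lies on both segments is the content of
`LoziSpectrum.lt_p_mul` and `LoziSpectrum.lt_p_sub_mul`. The second of these inequalities can fail
for `b` near `1`, but the two hypotheses together imply `b < 1 / 2` (`LoziSpectrum.b_lt`).
-/

/-! ### Affine maps of the plane -/

/-- The linear map of the plane with matrix `!![α, β; γ, δ]`. -/
noncomputable def planeLinear (α β γ δ : ℝ) : Plane →L[ℝ] Plane :=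
  LinearMap.toContinuousLinearMap
    (Matrix.toLin (EuclideanSpace.basisFun (Fin 2) ℝ).toBasis
      (EuclideanSpace.basisFun (Fin 2) ℝ).toBasis !![α, β; γ, δ])

theorem Plane.ext {P Q : Plane} (h₀ : P 0 = Q 0) (h₁ : P 1 = Q 1) : P = Q := by
  ext i
  fin_cases i
  · exact h₀
  · exact h₁

theorem planeLinear_apply_zero (α β γ δ : ℝ) (P : Plane) :
    planeLinear α β γ δ P 0 = α * P 0 + β * P 1 := by
  simp [planeLinear, Matrix.toLin_apply, Matrix.mulVec, dotProduct]

theorem planeLinear_apply_one (α β γ δ : ℝ) (P : Plane) :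
    planeLinear α β γ δ P 1 = γ * P 0 + δ * P 1 := by
  simp [planeLinear, Matrix.toLin_apply, Matrix.mulVec, dotProduct]

theorem planeLinear_det (α β γ δ : ℝ) :
    (planeLinear α β γ δ).det = α * δ - β * γ := by
  have h : (planeLinear α β γ δ).det = LinearMap.det
      (Matrix.toLin (EuclideanSpace.basisFun (Fin 2) ℝ).toBasis
      (EuclideanSpace.basisFun (Fin 2) ℝ).toBasis !![α, β; γ, δ]) := rfl
  rw [h, LinearMap.det_toLin, Matrix.det_fin_two_of]

theorem hasFDerivAt_planeLinear_add (α β γ δ : ℝ) (C P : Plane) :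
    HasFDerivAt (fun Q => planeLinear α β γ δ Q + C) (planeLinear α β γ δ) P :=
  (planeLinear α β γ δ).hasFDerivAt.add_const C

theorem contDiff_planeLinear_add (α β γ δ : ℝ) (C : Plane) :
    ContDiff ℝ 1 (fun Q => planeLinear α β γ δ Q + C) :=
  (planeLinear α β γ δ).contDiff.add contDiff_const

/-- The affine diffeomorphism `(x, y) ↦ (1 + y + s x, b x)`. The two branches of the Lozi family
are `henonBranch (a - c) b` and `henonBranch (-(a + c)) b`. -/
noncomputable def henonBranch (s b : ℝ) (hb : b ≠ 0) : PlaneDiffeo where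
  toFun P := planeLinear s 1 b 0 P + !₂[1, 0]
  invFun P := planeLinear 0 b⁻¹ 1 (-(s / b)) P + !₂[0, -1]
  left_inv P := by
    apply Plane.ext <;> simp [planeLinear_apply_zero, planeLinear_apply_one] <;> field_simp
    ring
  right_inv P := by
    apply Plane.ext <;> simp [planeLinear_apply_zero, planeLinear_apply_one] <;> field_simp
    ring
  contMDiff_toFun := (contDiff_planeLinear_add _ _ _ _ _).contMDiff
  contMDiff_invFun := (contDiff_planeLinear_add _ _ _ _ _).contMDiff

section henonBranch

variable (s b : ℝ) (hb : b ≠ 0) (P : Plane)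

theorem henonBranch_apply_zero : henonBranch s b hb P 0 = 1 + P 1 + s * P 0 := by
  have : henonBranch s b hb P = planeLinear s 1 b 0 P + !₂[1, 0] := rfl
  rw [this]
  simp [planeLinear_apply_zero]
  ring

theorem henonBranch_apply_one : henonBranch s b hb P 1 = b * P 0 := by
  have : henonBranch s b hb P = planeLinear s 1 b 0 P + !₂[1, 0] := rfl
  rw [this]
  simp [planeLinear_apply_one]

theorem fderiv_henonBranch : fderiv ℝ (henonBranch s b hb) P = planeLinear s 1 b 0 :=
  (hasFDerivAt_planeLinear_add _ _ _ _ _ _).fderiv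

theorem fderiv_henonBranch_symm :
    fderiv ℝ (henonBranch s b hb).symm P = planeLinear 0 b⁻¹ 1 (-(s / b)) :=
  (hasFDerivAt_planeLinear_add _ _ _ _ _ _).fderiv

theorem det_fderiv_henonBranch : (fderiv ℝ (henonBranch s b hb) P).det = -b := by
  rw [fderiv_henonBranch, planeLinear_det]
  ring

end henonBranch

/-! ### Cones around the coordinate axes -/

theorem Plane.norm_sq (u : Plane) : ‖u‖ ^ 2 = u 0 ^ 2 + u 1 ^ 2 := by
  rw [EuclideanSpace.norm_sq_eq]
  simp

theorem inv_sqrt_one_add_sq_lt_one {m : ℝ} (hm : 0 < m) : (√(1 + m ^ 2))⁻¹ < 1 := by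
  apply inv_lt_one_of_one_lt₀
  rw [Real.lt_sqrt] <;> nlinarith [sq_pos_of_pos hm]

/-- The cone `{|y| ≤ m |x|}` around the `x`-axis. -/
noncomputable def horizontalCone (m : ℝ) (hm : 0 < m) : Cone where
  v := !₂[1, 0]
  ℓ := (√(1 + m ^ 2))⁻¹
  norm_v := by simp [EuclideanSpace.norm_eq]
  ℓ_pos := by positivity
  ℓ_lt_one := inv_sqrt_one_add_sq_lt_one hm

/-- The cone `{|x| ≤ m |y|}` around the `y`-axis. -/
noncomputable def verticalCone (m : ℝ) (hm : 0 < m) : Cone where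
  v := !₂[0, 1]
  ℓ := (√(1 + m ^ 2))⁻¹
  norm_v := by simp [EuclideanSpace.norm_eq]
  ℓ_pos := by positivity
  ℓ_lt_one := inv_sqrt_one_add_sq_lt_one hm

theorem inv_sqrt_mul_le_abs_iff {m r s t : ℝ} (hm : 0 < m) (hr : 0 ≤ r)
    (h : r ^ 2 = s ^ 2 + t ^ 2) : (√(1 + m ^ 2))⁻¹ * r ≤ |s| ↔ |t| ≤ m * |s| := by
  have h1 : 0 < √(1 + m ^ 2) := by positivity
  have h2 : √(1 + m ^ 2) ^ 2 = 1 + m ^ 2 := Real.sq_sqrt (by positivity)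
  rw [inv_mul_le_iff₀ h1, ← abs_of_nonneg hr, ← abs_of_pos h1, ← abs_mul, ← sq_le_sq, mul_pow,
    h2, h, ← abs_of_pos hm, ← abs_mul, ← sq_le_sq, abs_of_pos hm]
  constructor <;> intro h <;> nlinarith

theorem mem_horizontalCone {m : ℝ} (hm : 0 < m) (u : Plane) :
    u ∈ (horizontalCone m hm).carrier ↔ |u 1| ≤ m * |u 0| := by
  have h : inner ℝ u (horizontalCone m hm).v = u 0 := by
    simp [horizontalCone, PiLp.inner_apply]
  rw [Cone.carrier, mem_ofPred_eq, h]
  exact inv_sqrt_mul_le_abs_iff hm (norm_nonneg u) (Plane.norm_sq u)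

theorem mem_verticalCone {m : ℝ} (hm : 0 < m) (u : Plane) :
    u ∈ (verticalCone m hm).carrier ↔ |u 0| ≤ m * |u 1| := by
  have h : inner ℝ u (verticalCone m hm).v = u 1 := by
    simp [verticalCone, PiLp.inner_apply]
  rw [Cone.carrier, mem_ofPred_eq, h]
  exact inv_sqrt_mul_le_abs_iff hm (norm_nonneg u) (by rw [Plane.norm_sq, add_comm])

theorem isUniversalPair_horizontalCone_verticalCone {m n : ℝ} (hm : 0 < m) (hn : 0 < n)
    (h : m * n < 1) : Cone.IsUniversalPair (horizontalCone m hm) (verticalCone n hn) := by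
  refine ⟨?_, ?_, ?_⟩
  · ext u
    rw [mem_inter_iff, mem_horizontalCone, mem_verticalCone, mem_singleton_iff]
    constructor
    · rintro ⟨h1, h2⟩
      have h0 : |u 0| = 0 := by
        nlinarith [abs_nonneg (u 0), mul_le_mul_of_nonneg_left h1 hn.le]
      have h3 : |u 1| = 0 := by
        rw [h0, mul_zero] at h1
        exact le_antisymm h1 (abs_nonneg _)
      exact Plane.ext (by simpa using h0) (by simpa using h3)
    · rintro rfl
      simp
  · ext u
    constructor
    · rintro ⟨t, rfl⟩
      simp [horizontalCone]
    · intro hu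
      exact ⟨u 0, Plane.ext (by simp [horizontalCone]) (by simpa [horizontalCone] using hu)⟩
  · ext u
    constructor
    · rintro ⟨t, rfl⟩
      simp [verticalCone]
    · intro hu
      exact ⟨u 1, Plane.ext (by simpa [verticalCone] using hu) (by simp [verticalCone])⟩

/-- The cone field with the same cone at every point. -/
def ConeField.const (K : Cone) : ConeField where
  cone _ := K
  continuous_v := continuous_const
  continuous_ℓ := continuous_const

theorem conesInvariant_henonBranch {s b m n : ℝ} (hb : 0 < b) (hm : 0 < m) (hn : 0 < n)
    (h₁ : b ≤ m * (|s| - m)) (h₂ : 1 ≤ n * (|s| - n * b)) :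
    ConesInvariant (henonBranch s b hb.ne') (ConeField.const (horizontalCone m hm))
      (ConeField.const (verticalCone n hn)) := by
  refine ⟨fun P => ?_, fun P => ?_⟩
  · rintro _ ⟨u, hu, rfl⟩
    simp only [ConeField.const, mem_horizontalCone] at hu ⊢
    rw [fderiv_henonBranch, planeLinear_apply_zero, planeLinear_apply_one]
    have h3 : (|s| - m) * |u 0| ≤ |s * u 0 + 1 * u 1| := by
      have := abs_sub_abs_le_abs_sub (s * u 0) (-u 1)
      rw [abs_neg, abs_mul, sub_neg_eq_add] at this
      rw [one_mul]
      linarith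
    have h4 : |b * u 0 + 0 * u 1| = b * |u 0| := by
      rw [zero_mul, add_zero, abs_mul, abs_of_pos hb]
    rw [h4]
    calc b * |u 0| ≤ m * (|s| - m) * |u 0| := mul_le_mul_of_nonneg_right h₁ (abs_nonneg _)
      _ ≤ m * |s * u 0 + 1 * u 1| := by
        rw [mul_assoc]; exact mul_le_mul_of_nonneg_left h3 hm.le
  · rintro _ ⟨u, hu, rfl⟩
    simp only [ConeField.const, mem_verticalCone] at hu ⊢
    rw [fderiv_henonBranch_symm, planeLinear_apply_zero, planeLinear_apply_one]
    have h3 : (|s| / b - n) * |u 1| ≤ |1 * u 0 + -(s / b) * u 1| := by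
      have := abs_sub_abs_le_abs_sub (s / b * u 1) (u 0)
      rw [abs_mul, abs_div, abs_of_pos hb, abs_sub_comm] at this
      rw [one_mul, neg_mul, ← sub_eq_add_neg]
      linarith
    have h4 : |0 * u 0 + b⁻¹ * u 1| = b⁻¹ * |u 1| := by
      rw [zero_mul, zero_add, abs_mul, abs_of_pos (inv_pos.2 hb)]
    have h5 : b⁻¹ ≤ n * (|s| / b - n) := by
      rw [inv_le_iff_one_le_mul₀ hb]
      have : n * (|s| / b - n) * b = n * (|s| - n * b) := by field_simp
      rw [this]
      exact h₂
    rw [h4]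
    calc b⁻¹ * |u 1| ≤ n * (|s| / b - n) * |u 1| := mul_le_mul_of_nonneg_right h5 (abs_nonneg _)
      _ ≤ n * |1 * u 0 + -(s / b) * u 1| := by
        rw [mul_assoc]; exact mul_le_mul_of_nonneg_left h3 hn.le

theorem conesStretched_henonBranch {s b m n L : ℝ} (hb : 0 < b) (hm : 0 < m) (hn : 0 < n)
    (hL : 0 ≤ L) (hs₁ : m ≤ |s|) (hs₂ : n * b ≤ |s|)
    (h₁ : L ^ 2 * (1 + m ^ 2) ≤ (|s| - m) ^ 2 + b ^ 2)
    (h₂ : L ^ 2 * (1 + n ^ 2) * b ^ 2 ≤ (|s| - n * b) ^ 2 + 1) :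
    ConesStretched (henonBranch s b hb.ne') (ConeField.const (horizontalCone m hm))
      (ConeField.const (verticalCone n hn)) L := by
  refine ⟨fun P u hu => ?_, fun P u hu => ?_⟩
  · simp only [ConeField.const, mem_horizontalCone] at hu
    rw [fderiv_henonBranch, ← abs_of_nonneg hL, ← abs_of_nonneg (norm_nonneg u),
      ← abs_of_nonneg (norm_nonneg (planeLinear _ _ _ _ _)), ← abs_mul, ← sq_le_sq, mul_pow,
      Plane.norm_sq, Plane.norm_sq, planeLinear_apply_zero, planeLinear_apply_one]
    have h3 : (|s| - m) * |u 0| ≤ |s * u 0 + 1 * u 1| := by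
      have := abs_sub_abs_le_abs_sub (s * u 0) (-u 1)
      rw [abs_neg, abs_mul, sub_neg_eq_add] at this
      rw [one_mul]
      linarith
    have h4 := mul_self_le_mul_self (mul_nonneg (sub_nonneg.2 hs₁) (abs_nonneg (u 0))) h3
    have h5 := mul_self_le_mul_self (abs_nonneg _) hu
    rw [abs_mul_abs_self] at h4 h5
    have h6 : |u 0| * |u 0| = u 0 ^ 2 := by rw [abs_mul_abs_self, sq]
    have h7 : u 1 ^ 2 ≤ m ^ 2 * u 0 ^ 2 := by rw [← h6]; linarith
    have h8 : (|s| - m) ^ 2 * u 0 ^ 2 ≤ (s * u 0 + 1 * u 1) ^ 2 := by rw [← h6]; linarith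
    have h9 := mul_le_mul_of_nonneg_left h7 (sq_nonneg L)
    have h10 := mul_le_mul_of_nonneg_right h₁ (sq_nonneg (u 0))
    nlinarith
  · simp only [ConeField.const, mem_verticalCone] at hu
    rw [fderiv_henonBranch_symm, ← abs_of_nonneg hL, ← abs_of_nonneg (norm_nonneg u),
      ← abs_of_nonneg (norm_nonneg (planeLinear _ _ _ _ _)), ← abs_mul, ← sq_le_sq, mul_pow,
      Plane.norm_sq, Plane.norm_sq, planeLinear_apply_zero, planeLinear_apply_one]
    have h3 : (|s| / b - n) * |u 1| ≤ |1 * u 0 + -(s / b) * u 1| := by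
      have := abs_sub_abs_le_abs_sub (s / b * u 1) (u 0)
      rw [abs_mul, abs_div, abs_of_pos hb, abs_sub_comm] at this
      rw [one_mul, neg_mul, ← sub_eq_add_neg]
      linarith
    have hs₃ : 0 ≤ |s| / b - n := by
      rw [sub_nonneg, le_div_iff₀ hb]; exact hs₂
    have h4 := mul_self_le_mul_self (mul_nonneg hs₃ (abs_nonneg (u 1))) h3
    have h5 := mul_self_le_mul_self (abs_nonneg _) hu
    rw [abs_mul_abs_self] at h4 h5
    have h6 : |u 1| * |u 1| = u 1 ^ 2 := by rw [abs_mul_abs_self, sq]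
    have h7 : u 0 ^ 2 ≤ n ^ 2 * u 1 ^ 2 := by rw [← h6]; linarith
    have h8 : (|s| / b - n) ^ 2 * u 1 ^ 2 ≤ (1 * u 0 + -(s / b) * u 1) ^ 2 := by
      rw [← h6]; linarith
    have h9 := mul_le_mul_of_nonneg_left h7 (sq_nonneg L)
    have h11 : L ^ 2 * (1 + n ^ 2) ≤ (|s| / b - n) ^ 2 + b⁻¹ ^ 2 := by
      have : (|s| / b - n) ^ 2 + b⁻¹ ^ 2 = ((|s| - n * b) ^ 2 + 1) / b ^ 2 := by field_simp
      rw [this, le_div_iff₀ (by positivity)]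
      exact h₂
    have h10 := mul_le_mul_of_nonneg_right h11 (sq_nonneg (u 1))
    nlinarith

/-! ### Spectral data of the two branches -/

/-- Every quadratic `t² - s t - b` with `b > 0` has one positive root `κ` and one negative
root `-ν`. -/
theorem exists_roots_of_pos (s : ℝ) {b : ℝ} (hb : 0 < b) :
    ∃ κ ν : ℝ, 0 < κ ∧ 0 < ν ∧ s = κ - ν ∧ b = κ * ν := by
  have h : |s| < √(s ^ 2 + 4 * b) := by
    rw [Real.lt_sqrt (abs_nonneg s), sq_abs]
    linarith
  have h' : √(s ^ 2 + 4 * b) ^ 2 = s ^ 2 + 4 * b := Real.sq_sqrt (by positivity)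
  rw [abs_lt] at h
  refine ⟨(√(s ^ 2 + 4 * b) + s) / 2, (√(s ^ 2 + 4 * b) - s) / 2, by linarith, by linarith,
    by ring, by nlinarith⟩

/-- The slopes `p`, `-q` of the two branches `(1 + y + p x, b x)` and `(1 + y - q x, b x)`,
together with the eigenvalues `κ₁, -ν₁` of the first and `-κ₂, ν₂` of the second, in the range of
parameters where the trapping triangle exists. The inequality `κ₁ κ₂ < p + q + b` says that the
image of the tip `(1 / (1 - ν₂), 0)` of the unstable manifold lies to the right of the stable
line of the left fixed point. -/
structure LoziSpectrum (b p q κ₁ ν₁ κ₂ ν₂ : ℝ) : Prop where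
  κ₁_pos : 0 < κ₁
  ν₁_pos : 0 < ν₁
  κ₂_pos : 0 < κ₂
  ν₂_pos : 0 < ν₂
  p_eq : p = κ₁ - ν₁
  q_eq : q = κ₂ - ν₂
  b_eq₁ : b = κ₁ * ν₁
  b_eq₂ : b = κ₂ * ν₂
  b_lt_one : b < 1
  p_le_q : p ≤ q
  lt_p : √2 * (1 + b / 2) < p
  mul_lt : κ₁ * κ₂ < p + q + b

/-- With `S = p + q + b`, the product of `S - κ₁ κ₂`, `S - ν₁ ν₂`, `S + κ₁ ν₂` and `S + ν₁ κ₂`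
is a polynomial in `p`, `q`, `b`, and it factors as `(S - b)²` times
`(S + b)² - S (p + b) (q + b)`. All but the first of the four are positive. -/
theorem mul_lt_of_quadratic {b p q κ₁ ν₁ κ₂ ν₂ : ℝ} (hκ₁ : 0 < κ₁) (hν₁ : 0 < ν₁) (hκ₂ : 0 < κ₂)
    (hν₂ : 0 < ν₂) (hp : p = κ₁ - ν₁) (hq : q = κ₂ - ν₂) (hb₁ : b = κ₁ * ν₁) (hb₂ : b = κ₂ * ν₂)
    (hp₀ : 1 < p) (hq₀ : 1 < q) (hb : b < 1)
    (h : (p + q + b) * ((p + b) * (q + b)) < (p + q + 2 * b) ^ 2) : κ₁ * κ₂ < p + q + b := by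
  obtain ⟨S, hS⟩ : ∃ S, S = p + q + b := ⟨_, rfl⟩
  have hb₀ : 0 < b := by rw [hb₁]; positivity
  have hf : (S - κ₁ * κ₂) * ((S - ν₁ * ν₂) * (S + κ₁ * ν₂) * (S + ν₁ * κ₂)) =
      (S - b) ^ 2 * ((p + q + 2 * b) ^ 2 - (p + q + b) * ((p + b) * (q + b))) := by
    have e1 : (S - κ₁ * κ₂) * (S - ν₁ * ν₂) =
        S ^ 2 - (κ₁ * κ₂ + ν₁ * ν₂) * S + b ^ 2 := by
      linear_combination (-κ₁ * ν₁) * hb₂ - b * hb₁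
    have e2 : (S + κ₁ * ν₂) * (S + ν₁ * κ₂) =
        S ^ 2 + (κ₁ * ν₂ + ν₁ * κ₂) * S + b ^ 2 := by
      linear_combination (-κ₁ * ν₁) * hb₂ - b * hb₁
    have e3 : (κ₁ * κ₂ + ν₁ * ν₂) - (κ₁ * ν₂ + ν₁ * κ₂) = p * q := by rw [hp, hq]; ring
    have e4 : (κ₁ * κ₂ + ν₁ * ν₂) * (κ₁ * ν₂ + ν₁ * κ₂) =
        b * (p ^ 2 + q ^ 2 + 4 * b) := by
      have h1 : p ^ 2 + 2 * b = κ₁ ^ 2 + ν₁ ^ 2 := by rw [hp, hb₁]; ring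
      have h2 : q ^ 2 + 2 * b = κ₂ ^ 2 + ν₂ ^ 2 := by rw [hq, hb₂]; ring
      linear_combination (-κ₁ ^ 2 - ν₁ ^ 2) * hb₂ - b * h1 - b * h2 - (κ₂ ^ 2 + ν₂ ^ 2) * hb₁
    calc _ = ((S - κ₁ * κ₂) * (S - ν₁ * ν₂)) * ((S + κ₁ * ν₂) * (S + ν₁ * κ₂)) := by ring
      _ = _ := by
        rw [e1, e2]
        have e5 : (κ₁ * κ₂ + ν₁ * ν₂) = p * q + (κ₁ * ν₂ + ν₁ * κ₂) := by linarith
        have e6 : (S ^ 2 - (κ₁ * κ₂ + ν₁ * ν₂) * S + b ^ 2) *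
            (S ^ 2 + (κ₁ * ν₂ + ν₁ * κ₂) * S + b ^ 2) =
            (S ^ 2 + b ^ 2) ^ 2 - p * q * S * (S ^ 2 + b ^ 2)
              - b * (p ^ 2 + q ^ 2 + 4 * b) * S ^ 2 := by
          linear_combination (-S * (S ^ 2 + b ^ 2)) * e3 - S ^ 2 * e4
        rw [e6, hS]
        ring
  have h1 : ν₁ * ν₂ < S := by
    have : ν₁ < 1 := by nlinarith
    have : ν₂ < 1 := by nlinarith
    nlinarith
  have h2 : 0 < (S - ν₁ * ν₂) * (S + κ₁ * ν₂) * (S + ν₁ * κ₂) := by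
    have : 0 < S := by linarith
    have : 0 < S - ν₁ * ν₂ := by linarith
    positivity
  have h3 : 0 < (S - κ₁ * κ₂) * ((S - ν₁ * ν₂) * (S + κ₁ * ν₂) * (S + ν₁ * κ₂)) := by
    rw [hf]
    have : 0 < S - b := by linarith
    have : 0 < (p + q + 2 * b) ^ 2 - (p + q + b) * ((p + b) * (q + b)) := by linarith
    positivity
  have := pos_of_mul_pos_left h3 h2.le
  linarith

theorem exists_loziSpectrum {a b c : ℝ} (hb : 0 < b) (hb₁ : b < 1) (hc : 0 ≤ c)
    (hA2 : (2 * a + b) * (1 - c ^ 2 / (a + b) ^ 2) < 4) (hA3 : (a - c) * √2 > b + 2) :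
    ∃ κ₁ ν₁ κ₂ ν₂ : ℝ, LoziSpectrum b (a - c) (a + c) κ₁ ν₁ κ₂ ν₂ := by
  obtain ⟨κ₁, ν₁, hκ₁, hν₁, hp, hb₁'⟩ := exists_roots_of_pos (a - c) hb
  obtain ⟨κ₂, ν₂, hκ₂, hν₂, hq, hb₂'⟩ := exists_roots_of_pos (a + c) hb
  have h2 : √2 * √2 = 2 := Real.mul_self_sqrt (by norm_num)
  have h20 : 0 < √2 := by positivity
  have hlt : √2 * (1 + b / 2) < a - c := by
    refine lt_of_mul_lt_mul_right ?_ h20.le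
    linear_combination hA3 + (1 + b / 2) * h2
  have h21 : 1 < √2 := by nlinarith
  have h3 : 0 < √2 * b := by positivity
  refine ⟨κ₁, ν₁, κ₂, ν₂, hκ₁, hν₁, hκ₂, hν₂, hp, hq, hb₁', hb₂', hb₁, by linarith, hlt, ?_⟩
  apply mul_lt_of_quadratic hκ₁ hν₁ hκ₂ hν₂ hp hq hb₁' hb₂' (by linarith) (by linarith) hb₁
  have h4 : 0 < a + b := by linarith
  have h5 : (2 * a + b) * (1 - c ^ 2 / (a + b) ^ 2) * (a + b) ^ 2 =
      (2 * a + b) * ((a + b) ^ 2 - c ^ 2) := by field_simp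
  have h6 := mul_lt_mul_of_pos_right hA2 (pow_pos h4 2)
  rw [h5] at h6
  nlinarith

namespace LoziSpectrum

variable {b p q κ₁ ν₁ κ₂ ν₂ : ℝ}

theorem b_pos (h : LoziSpectrum b p q κ₁ ν₁ κ₂ ν₂) : 0 < b := by
  rw [h.b_eq₁]; exact mul_pos h.κ₁_pos h.ν₁_pos

theorem sqrt_two_lt_p (h : LoziSpectrum b p q κ₁ ν₁ κ₂ ν₂) : √2 < p := by
  have h1 := h.lt_p
  have : 0 < √2 * b := mul_pos (by positivity) h.b_pos
  linarith

theorem κ₁_le_κ₂ (h : LoziSpectrum b p q κ₁ ν₁ κ₂ ν₂) : κ₁ ≤ κ₂ := by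
  by_contra! hlt
  have h1 := h.p_le_q
  rw [h.p_eq, h.q_eq] at h1
  have h2 : κ₂ * ν₂ < κ₁ * ν₁ :=
    mul_lt_mul'' hlt (by linarith) h.κ₂_pos.le h.ν₂_pos.le
  rw [← h.b_eq₁, ← h.b_eq₂] at h2
  exact lt_irrefl _ h2

theorem ν₂_le_ν₁ (h : LoziSpectrum b p q κ₁ ν₁ κ₂ ν₂) : ν₂ ≤ ν₁ := by
  by_contra! hlt
  have h2 : κ₁ * ν₁ < κ₂ * ν₂ := mul_lt_mul' h.κ₁_le_κ₂ hlt h.ν₁_pos.le h.κ₂_pos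
  rw [← h.b_eq₁, ← h.b_eq₂] at h2
  exact lt_irrefl _ h2

theorem ν₁_lt (h : LoziSpectrum b p q κ₁ ν₁ κ₂ ν₂) : ν₁ < b * √2 / 2 := by
  have h1 : √2 < κ₁ := by linarith [h.sqrt_two_lt_p, h.p_eq, h.ν₁_pos]
  have h2 : √2 * √2 = 2 := Real.mul_self_sqrt (by norm_num)
  have h3 : √2 * ν₁ < b := by rw [h.b_eq₁]; exact mul_lt_mul_of_pos_right h1 h.ν₁_pos
  have h4 := mul_lt_mul_of_pos_left h3 (show 0 < √2 by positivity)
  rw [← mul_assoc, h2] at h4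
  linarith

theorem κ₁_lt_two (h : LoziSpectrum b p q κ₁ ν₁ κ₂ ν₂) : κ₁ < 2 := by
  have h0 := h.mul_lt
  have h1 := h.κ₁_le_κ₂
  have hp := h.sqrt_two_lt_p
  have hs : 1.4 < √2 := Real.lt_sqrt_of_sq_lt (by norm_num)
  have hb := h.b_lt_one
  have hpe := h.p_eq
  have hqe := h.q_eq
  have hν₁ := h.ν₁_pos
  have hκ₂ := h.κ₂_pos
  -- `t ↦ t (κ₁ - 1) + b / t` increases on `[κ₁, ∞)`, so `κ₂` may be replaced by `κ₁`
  have h2 : κ₁ * (κ₁ - 1) + ν₁ ≤ κ₂ * (κ₁ - 1) + ν₂ := by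
    have h3 : (ν₁ - ν₂) * κ₂ = ν₁ * (κ₂ - κ₁) := by linear_combination h.b_eq₂ - h.b_eq₁
    have h4 : ν₁ - ν₂ ≤ (κ₂ - κ₁) * (κ₁ - 1) := by
      refine le_of_mul_le_mul_right ?_ hκ₂
      rw [h3]
      have h5 : ν₁ ≤ κ₂ * (κ₁ - 1) := by
        have := h.p_eq
        have h6 : b ≤ κ₁ * (κ₂ * (κ₁ - 1)) := by
          have h7 := h.lt_p
          have h8 : 0.4 + 0.7 * b ≤ κ₁ - 1 := by nlinarith [h.b_pos]
          have h9 : 1.4 * 1.4 ≤ κ₁ * κ₂ := mul_le_mul (by linarith) (by linarith)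
            (by norm_num) h.κ₁_pos.le
          nlinarith [h.b_pos]
        rw [h.b_eq₁] at h6
        exact le_of_mul_le_mul_left h6 h.κ₁_pos
      nlinarith
    linarith
  have h5 : (κ₁ - 2) * (κ₁ - ν₁) < 0 := by
    have := h.b_eq₁
    nlinarith
  rw [← hpe] at h5
  nlinarith

theorem b_lt (h : LoziSpectrum b p q κ₁ ν₁ κ₂ ν₂) : b < 1 / 2 := by
  have h1 := h.κ₁_lt_two
  have hs : 1.4 < √2 := Real.lt_sqrt_of_sq_lt (by norm_num)
  have h2 := h.lt_p
  have h3 := h.p_eq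
  have h4 := h.b_eq₁
  have hb := h.b_pos
  have h5 : b < 2 * ν₁ := by
    rw [h4]; exact mul_lt_mul_of_pos_right h1 h.ν₁_pos
  nlinarith

/-- This places the third image of `D` to the left of the stable line of the right fixed
point. -/
theorem lt_p_mul (h : LoziSpectrum b p q κ₁ ν₁ κ₂ ν₂) :
    2 * b * κ₂ - ν₂ + κ₂ < p * (κ₂ ^ 2 - 1) := by
  have hs : 1.4 < √2 := Real.lt_sqrt_of_sq_lt (by norm_num)
  have h2 : √2 * √2 = 2 := Real.mul_self_sqrt (by norm_num)
  have hb := h.b_pos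
  have hκ : √2 * (1 + b / 2) < κ₂ := by linarith [h.lt_p, h.p_le_q, h.q_eq, h.ν₂_pos]
  have hκ' : √2 < κ₂ := by nlinarith
  have h3 : √2 * (1 + b / 2) * (κ₂ ^ 2 - 1) ≤ p * (κ₂ ^ 2 - 1) :=
    mul_le_mul_of_nonneg_right h.lt_p.le (by nlinarith)
  refine lt_of_lt_of_le ?_ h3
  have h4 : (√2 * b / 2) * (√2 * κ₂ + 1) ≤ (κ₂ - √2) * (√2 * κ₂ + 1) :=
    mul_le_mul_of_nonneg_right (by linarith) (by have := h.κ₂_pos; positivity)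
  have h5 : 0 ≤ b * κ₂ * (√2 * κ₂ - 2) := by
    have : 0 ≤ √2 * κ₂ - 2 := by nlinarith
    have := h.κ₂_pos
    positivity
  nlinarith [h.ν₂_pos]

/-- This places the point where the arc from `F³(D)` to `F(D)` meets the divider above `M`. -/
theorem lt_p_sub_mul (h : LoziSpectrum b p q κ₁ ν₁ κ₂ ν₂) :
    ν₂ + b < (p - ν₂) * (1 - ν₂) := by
  have hs : 1.4 < √2 := Real.lt_sqrt_of_sq_lt (by norm_num)
  have hs' : √2 < 1.42 := by rw [Real.sqrt_lt' (by norm_num)]; norm_num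
  have hν : ν₂ < b * √2 / 2 := h.ν₂_le_ν₁.trans_lt h.ν₁_lt
  have hb := h.b_lt
  have hp := h.lt_p
  have hν' : ν₂ < 0.355 := by nlinarith [h.b_pos]
  have h1 : 1.4 * (1 - ν₂) < (p - ν₂) * (1 - ν₂) :=
    mul_lt_mul_of_pos_right (by linarith) (by linarith)
  linarith

theorem ν₂_lt_one (h : LoziSpectrum b p q κ₁ ν₁ κ₂ ν₂) : ν₂ < 1 := by
  have hs : √2 < 2 := by rw [Real.sqrt_lt' (by norm_num)]; norm_num
  nlinarith [h.ν₂_le_ν₁, h.ν₁_lt, h.b_lt_one, h.b_pos]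

theorem one_lt_κ₁ (h : LoziSpectrum b p q κ₁ ν₁ κ₂ ν₂) : 1 < κ₁ := by
  have hs : 1.4 < √2 := Real.lt_sqrt_of_sq_lt (by norm_num)
  linarith [h.sqrt_two_lt_p, h.p_eq, h.ν₁_pos]

end LoziSpectrum

/-! ### Synchronous hyperbolicity -/

theorem exists_stretch_gt_sqrt_two {b t : ℝ} (hb : 0 < b) (hb₁ : b < 1) (ht : √2 < t) :
    ∃ L : ℝ, √2 < L ∧ L ^ 2 * (1 + (b * √2 / 2) ^ 2) ≤ t ^ 2 + b ^ 2 ∧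
      L ^ 2 * (1 + (√2 / 2) ^ 2) * b ^ 2 ≤ t ^ 2 + 1 := by
  have h2 : √2 ^ 2 = 2 := Real.sq_sqrt (by norm_num)
  have ht2 : 2 < t ^ 2 := by rw [← h2]; gcongr
  have hb2 : b ^ 2 < 1 := by nlinarith
  have e1 : 1 + (b * √2 / 2) ^ 2 = (2 + b ^ 2) / 2 := by linear_combination b ^ 2 / 4 * h2
  have e2 : 1 + (√2 / 2) ^ 2 = 3 / 2 := by linear_combination 1 / 4 * h2
  obtain ⟨m, hm⟩ : ∃ m, m = min ((t ^ 2 + b ^ 2) / ((2 + b ^ 2) / 2))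
    ((t ^ 2 + 1) / (3 / 2 * b ^ 2)) := ⟨_, rfl⟩
  have hm2 : 2 < m := by
    rw [hm, lt_min_iff, lt_div_iff₀ (by positivity), lt_div_iff₀ (by positivity)]
    constructor <;> linarith
  refine ⟨√m, Real.sqrt_lt_sqrt (by norm_num) hm2, ?_, ?_⟩
  · rw [Real.sq_sqrt (by linarith), e1, ← le_div_iff₀ (by positivity), hm]
    exact min_le_left _ _
  · rw [Real.sq_sqrt (by linarith), e2, mul_assoc, ← le_div_iff₀ (by positivity), hm]
    exact min_le_right _ _

/-- The branches with slopes `p` and `-q` are synchronously hyperbolic, with constant cone fields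
`{|y| ≤ (b / √2) |x|}` and `{|x| ≤ |y| / √2}` and the `y`-axis as the divider. These are the
cones that are invariant in the limiting case `p = √2 + b / √2`. -/
noncomputable def loziSynchronouslyHyperbolic {b p q L : ℝ} (hb : 0 < b) (hb₁ : b < 1)
    (hp : √2 * (1 + b / 2) < p) (hpq : p ≤ q) (hL : 1 < L)
    (h₁ : L ^ 2 * (1 + (b * √2 / 2) ^ 2) ≤ (p - b * √2 / 2) ^ 2 + b ^ 2)
    (h₂ : L ^ 2 * (1 + (√2 / 2) ^ 2) * b ^ 2 ≤ (p - b * √2 / 2) ^ 2 + 1) :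
    SynchronouslyHyperbolic (henonBranch p b hb.ne') (henonBranch (-q) b hb.ne') :=
  have hm : 0 < b * √2 / 2 := by positivity
  have hn : 0 < √2 / 2 := by positivity
  have h2 : √2 * √2 = 2 := Real.mul_self_sqrt (by norm_num)
  have h20 : 0 < √2 := by positivity
  have hinv : ∀ s : ℝ, p ≤ |s| → ConesInvariant (henonBranch s b hb.ne')
      (ConeField.const (horizontalCone (b * √2 / 2) hm))
      (ConeField.const (verticalCone (√2 / 2) hn)) := fun s hs => by
    apply conesInvariant_henonBranch hb hm hn
    · have := mul_le_mul_of_nonneg_left (show √2 ≤ |s| - b * √2 / 2 by linarith) hm.le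
      nlinarith
    · have := mul_le_mul_of_nonneg_left (show √2 ≤ |s| - √2 / 2 * b by linarith) hn.le
      nlinarith
  have hst : ∀ s : ℝ, p ≤ |s| → ConesStretched (henonBranch s b hb.ne')
      (ConeField.const (horizontalCone (b * √2 / 2) hm))
      (ConeField.const (verticalCone (√2 / 2) hn)) L := fun s hs => by
    have h3 : (p - b * √2 / 2) ^ 2 ≤ (|s| - b * √2 / 2) ^ 2 := by
      have : 0 ≤ p - b * √2 / 2 := by linarith
      gcongr
    apply conesStretched_henonBranch hb hm hn (by linarith) (by linarith) (by linarith)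
    · linarith
    · rw [show √2 / 2 * b = b * √2 / 2 by ring]
      linarith
  have hp₀ : 0 < p := lt_trans (by positivity) hp
  have habs : p ≤ |p| := le_abs_self p
  have habs' : p ≤ |-q| := by rw [abs_neg]; exact hpq.trans (le_abs_self q)
  have himage : ∀ s y : ℝ, fderiv ℝ (henonBranch s b hb.ne') !₂[(0 : ℝ), y]
      !₂[deriv (fun _ : ℝ => (0 : ℝ)) y, 1] ∈ (horizontalCone (b * √2 / 2) hm).carrier :=
    fun s y => by
      rw [mem_horizontalCone, fderiv_henonBranch, planeLinear_apply_zero, planeLinear_apply_one]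
      simp
      positivity
  { stretch := L
    one_lt_stretch := hL
    Ku := horizontalCone (b * √2 / 2) hm
    Ks := verticalCone (√2 / 2) hn
    universal := isUniversalPair_horizontalCone_verticalCone hm hn (by nlinarith)
    Cu := ConeField.const (horizontalCone (b * √2 / 2) hm)
    Cs := ConeField.const (verticalCone (√2 / 2) hn)
    orientation := Or.inr ⟨fun P => by rw [det_fderiv_henonBranch]; linarith,
      fun P => by rw [det_fderiv_henonBranch]; linarith⟩
    Cu_subset := fun P => Subset.rfl
    Cs_subset := fun P => Subset.rfl
    invariant₁ := hinv p habs
    invariant₂ := hinv (-q) habs'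
    stretched₁ := hst p habs
    stretched₂ := hst (-q) habs'
    divider := fun _ => 0
    divider_smooth := contDiff_const
    agree := fun y => by
      apply Plane.ext <;> simp [henonBranch_apply_zero, henonBranch_apply_one]
    tangent_mem := fun y => by
      simp only [ConeField.const]
      rw [mem_verticalCone]
      simpa using hn.le
    image_tangent_mem₁ := himage p
    image_tangent_mem₂ := himage (-q) }

/-! ### The trapping triangle -/

/-- The open triangle cut out by a line of slope `-n` from above, a line of slope `s` from below
and a line of slope `-k` from the left. -/
def openTriangle (n s k A B C : ℝ) : Set Plane :=
  {P | P 1 + n * P 0 < A ∧ -B < P 1 - s * P 0 ∧ C < P 1 + k * P 0}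

/-- The closed triangle with the same sides as `openTriangle n s k A B C`. -/
def closedTriangle (n s k A B C : ℝ) : Set Plane :=
  {P | P 1 + n * P 0 ≤ A ∧ -B ≤ P 1 - s * P 0 ∧ C ≤ P 1 + k * P 0}

section Triangle

variable (n s k A B C : ℝ)

theorem isOpen_openTriangle : IsOpen (openTriangle n s k A B C) := by
  have h₁ : IsOpen {P : Plane | P 1 + n * P 0 < A} := isOpen_lt (by fun_prop) (by fun_prop)
  have h₂ : IsOpen {P : Plane | -B < P 1 - s * P 0} := isOpen_lt (by fun_prop) (by fun_prop)
  have h₃ : IsOpen {P : Plane | C < P 1 + k * P 0} := isOpen_lt (by fun_prop) (by fun_prop)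
  exact h₁.inter (h₂.inter h₃)

theorem closure_openTriangle_subset :
    closure (openTriangle n s k A B C) ⊆ closedTriangle n s k A B C := by
  apply closure_minimal
  · exact fun P ⟨h₁, h₂, h₃⟩ => ⟨h₁.le, h₂.le, h₃.le⟩
  · have h₁ : IsClosed {P : Plane | P 1 + n * P 0 ≤ A} := isClosed_le (by fun_prop) (by fun_prop)
    have h₂ : IsClosed {P : Plane | -B ≤ P 1 - s * P 0} := isClosed_le (by fun_prop) (by fun_prop)
    have h₃ : IsClosed {P : Plane | C ≤ P 1 + k * P 0} := isClosed_le (by fun_prop) (by fun_prop)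
    exact h₁.inter (h₂.inter h₃)

theorem convex_openTriangle : Convex ℝ (openTriangle n s k A B C) := by
  rintro P ⟨h₁, h₂, h₃⟩ Q ⟨h₁', h₂', h₃'⟩ u v hu hv huv
  simp only [openTriangle, mem_ofPred_eq, PiLp.add_apply, PiLp.smul_apply, smul_eq_mul]
  have key : ∀ {x x' y : ℝ}, x < y → x' < y → u * x + v * x' < y := fun {x x' y} hx hx' => by
    have := (convex_Iio (𝕜 := ℝ) y) hx hx' hu hv huv
    simpa using this
  refine ⟨?_, ?_, ?_⟩
  · linarith [key h₁ h₁']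
  · linarith [key (neg_lt.1 h₂) (neg_lt.1 h₂')]
  · linarith [key (neg_lt_neg h₃) (neg_lt_neg h₃')]

variable {n s k}

theorem isBounded_openTriangle (hns : 0 < n + s) (hnk : n < k) :
    Bornology.IsBounded (openTriangle n s k A B C) := by
  set X := |(C - A) / (k - n)| + |(A + B) / (n + s)| with hX
  rw [isBounded_iff_forall_norm_le]
  refine ⟨X + (|A| + |n| * X + (|B| + |s| * X)), ?_⟩
  rintro P ⟨h₁, h₂, h₃⟩
  have hx : |P 0| ≤ X := by
    have h4 : (C - A) / (k - n) ≤ P 0 := by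
      rw [div_le_iff₀ (by linarith)]; linarith
    have h5 : P 0 ≤ (A + B) / (n + s) := by
      rw [le_div_iff₀ hns]; linarith
    rw [abs_le]
    constructor
    · linarith [neg_abs_le ((C - A) / (k - n)), abs_nonneg ((A + B) / (n + s))]
    · linarith [le_abs_self ((A + B) / (n + s)), abs_nonneg ((C - A) / (k - n))]
  have hX0 : 0 ≤ X := (abs_nonneg _).trans hx
  have h6 : |n * P 0| ≤ |n| * X := by rw [abs_mul]; gcongr
  have h7 : |s * P 0| ≤ |s| * X := by rw [abs_mul]; gcongr
  have hy : |P 1| ≤ |A| + |n| * X + (|B| + |s| * X) := by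
    have : 0 ≤ |n| * X := by positivity
    have : 0 ≤ |s| * X := by positivity
    rw [abs_le]
    constructor
    · linarith [neg_abs_le (s * P 0), le_abs_self B, abs_nonneg A]
    · linarith [neg_abs_le (n * P 0), le_abs_self A, abs_nonneg B]
  have hle : ‖P‖ ≤ |P 0| + |P 1| := by
    apply le_of_sq_le_sq _ (by positivity)
    rw [Plane.norm_sq, ← sq_abs (P 0), ← sq_abs (P 1)]
    nlinarith [abs_nonneg (P 0), abs_nonneg (P 1)]
  linarith

end Triangle

/-- Bounded convex open sets of the plane are disks. -/
theorem Convex.nonempty_homeomorph_ball {U : Set Plane} (hc : Convex ℝ U) (ho : IsOpen U)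
    (hne : U.Nonempty) (hb : Bornology.IsBounded U) :
    Nonempty (U ≃ₜ Metric.ball (0 : Plane) 1) ∧
      Nonempty (closure U ≃ₜ Metric.closedBall (0 : Plane) 1) := by
  obtain ⟨e, h₁, h₂, -⟩ := exists_homeomorph_image_interior_closure_frontier_eq_unitBall hc
    (by rwa [ho.interior_eq]) hb
  rw [ho.interior_eq] at h₁
  exact ⟨⟨(e.image U).trans (Homeomorph.setCongr h₁)⟩,
    ⟨(e.image (closure U)).trans (Homeomorph.setCongr h₂)⟩⟩

/-! ### The trapping property -/

namespace LoziSpectrum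

variable {b p q κ₁ ν₁ κ₂ ν₂ : ℝ}

/-- Room for the left side `y + κ₁ x = C` of the trapping triangle. The stable line of the left
fixed point is `y + κ₁ x = -κ₁ / (κ₁ - 1)`, and `C` may be taken slightly above this value; the last
inequality bounds `y + κ₁ x` from below at `F²(D)`, where `w` is the abscissa of `F(D)`, up to a
perturbation of size `ε`. It is `κ₁ κ₂ < p + q + b` that makes the two compatible. -/
theorem exists_offsets (h : LoziSpectrum b p q κ₁ ν₁ κ₂ ν₂) {w : ℝ} (hw : w * (1 - ν₂) = 1)
    (K : ℝ) : ∃ ε C : ℝ, 0 < ε ∧ C < 0 ∧ C < κ₁ * (1 + C) ∧ -κ₁ < C * (κ₁ - 1) ∧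
      C < κ₁ * (1 - (q - ν₁) * w - ε * K) := by
  have hκ := h.one_lt_κ₁
  have hν := h.ν₂_lt_one
  obtain ⟨z, hz⟩ : ∃ z, z * (κ₁ - 1) = -κ₁ :=
    ⟨-κ₁ / (κ₁ - 1), div_mul_cancel₀ _ (by linarith)⟩
  have hz0 : z < 0 := by nlinarith
  have hgap : z < κ₁ * (1 - (q - ν₁) * w) := by
    refine lt_of_mul_lt_mul_right (a := (κ₁ - 1) * (1 - ν₂)) ?_
      (mul_nonneg (by linarith) (by linarith))
    have h1 : κ₁ * (1 - (q - ν₁) * w) * ((κ₁ - 1) * (1 - ν₂)) =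
        κ₁ * ((κ₁ - 1) * (1 - ν₂ - (q - ν₁))) := by
      linear_combination (-κ₁ * (q - ν₁) * (κ₁ - 1)) * hw
    have h2 : z * ((κ₁ - 1) * (1 - ν₂)) = κ₁ * (-(1 - ν₂)) := by
      linear_combination (1 - ν₂) * hz
    rw [h1, h2]
    apply mul_lt_mul_of_pos_left _ h.κ₁_pos
    have := h.mul_lt
    have := h.p_eq
    have := h.q_eq
    have := h.b_eq₁
    have := h.b_eq₂
    nlinarith
  obtain ⟨g, hg, hgz, hgw⟩ : ∃ g > 0, g ≤ -z / 2 ∧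
      g ≤ (κ₁ * (1 - (q - ν₁) * w) - z) / 2 :=
    ⟨min (-z / 2) ((κ₁ * (1 - (q - ν₁) * w) - z) / 2), lt_min (by linarith) (by linarith),
      min_le_left _ _, min_le_right _ _⟩
  have hK : 0 < κ₁ * (|K| + 1) := mul_pos h.κ₁_pos (by positivity)
  refine ⟨g / (κ₁ * (|K| + 1)), z + g, by positivity, by linarith, by nlinarith, by nlinarith, ?_⟩
  have h3 : κ₁ * (g / (κ₁ * (|K| + 1)) * K) < g := by
    have h4 : K < |K| + 1 := by linarith [le_abs_self K]
    have h5 : κ₁ * (g / (κ₁ * (|K| + 1)) * K) = g * (K / (|K| + 1)) := by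
      have := h.κ₁_pos
      field_simp
    rw [h5]
    have h6 : K / (|K| + 1) < 1 := by rw [div_lt_one (by positivity)]; exact h4
    nlinarith
  linarith

end LoziSpectrum

theorem loziFamily_apply_zero (a b c : ℝ) (P : Plane) :
    loziFamily a b c P 0 = 1 + P 1 - a * |P 0| - c * P 0 := rfl

theorem loziFamily_apply_one (a b c : ℝ) (P : Plane) : loziFamily a b c P 1 = b * P 0 := rfl

theorem loziFamily_eq_left (a c : ℝ) {b : ℝ} (hb : b ≠ 0) {P : Plane} (hP : P 0 ≤ 0) :
    loziFamily a b c P = henonBranch (a - c) b hb P := by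
  apply Plane.ext
  · rw [loziFamily_apply_zero, henonBranch_apply_zero, abs_of_nonpos hP]
    ring
  · rw [loziFamily_apply_one, henonBranch_apply_one]

theorem loziFamily_eq_right (a c : ℝ) {b : ℝ} (hb : b ≠ 0) {P : Plane} (hP : 0 ≤ P 0) :
    loziFamily a b c P = henonBranch (-(a + c)) b hb P := by
  apply Plane.ext
  · rw [loziFamily_apply_zero, henonBranch_apply_zero, abs_of_nonneg hP]
    ring
  · rw [loziFamily_apply_one, henonBranch_apply_one]

/-- The closed triangle is mapped into the open one.
The upper side of the triangle is parallel to the unstable line of the right fixed point,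
the lower side to its image under the left branch, and the left side to the stable line of the
left fixed point. For each side, the image of each
half of the triangle is kept on the inner side of the line that carries it. -/
theorem loziFamily_mem_openTriangle {a b c κ₁ ν₁ κ₂ ν₂ w s ε C : ℝ}
    (h : LoziSpectrum b (a - c) (a + c) κ₁ ν₁ κ₂ ν₂) (hw : w * (1 - ν₂) = 1)
    (hs : s * (a - c - ν₂) = b) (hε : 0 < ε) (hC : C < κ₁ * (1 + C))
    (hgap : C < κ₁ * (1 - (a + c - ν₁) * w -
      ε * (2 * s + (a + c - ν₁ - s) * ((2 * s + 1) / (s + ν₂)))))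
    {P : Plane} (hP : P ∈ closedTriangle ν₂ s κ₁ (ν₂ * w + ε) (s * (w + 2 * ε)) C) :
    loziFamily a b c P ∈ openTriangle ν₂ s κ₁ (ν₂ * w + ε) (s * (w + 2 * ε)) C := by
  obtain ⟨h₁, h₂, h₃⟩ := hP
  have hν₁ := h.ν₁_pos
  have hκ₁ := h.κ₁_pos
  have hν₂ := h.ν₂_pos
  have hκ₂ := h.κ₂_pos
  have hν₂1 := h.ν₂_lt_one
  have hb := h.b_pos
  have hp := h.sqrt_two_lt_p
  have hsq : 1.4 < √2 := Real.lt_sqrt_of_sq_lt (by norm_num)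
  have hν₂' : ν₂ < b * √2 / 2 := h.ν₂_le_ν₁.trans_lt h.ν₁_lt
  have hpν : √2 < a - c - ν₂ := by linarith [h.lt_p]
  have hs0 : 0 < s := pos_of_mul_pos_left (hs ▸ hb) (by linarith)
  have hs1 : s < 1 := by nlinarith [h.b_lt_one]
  have hb₁ := h.b_eq₁
  have hb₂ := h.b_eq₂
  have hpe := h.p_eq
  have hqe := h.q_eq
  have hνε : ν₂ * ε < ε := by nlinarith
  have hsε : 0 < s * ε := mul_pos hs0 hε
  simp only [openTriangle, mem_ofPred_eq, loziFamily_apply_zero, loziFamily_apply_one]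
  generalize P 0 = x at *
  generalize P 1 = y at *
  rcases le_total x 0 with hx | hx
  · rw [abs_of_nonpos hx]
    refine ⟨?_, ?_, ?_⟩
    · have e : b * x + ν₂ * (1 + y - a * -x - c * x) =
          ν₂ * (1 + (y + ν₂ * x)) + ν₂ * ((κ₂ + (a - c - ν₂)) * x) := by
        linear_combination x * hb₂
      have h4 : ν₂ * (1 + (y + ν₂ * x)) ≤ ν₂ * (1 + (ν₂ * w + ε)) := by gcongr
      have h5 : ν₂ * ((κ₂ + (a - c - ν₂)) * x) ≤ 0 :=
        mul_nonpos_of_nonneg_of_nonpos hν₂.le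
          (mul_nonpos_of_nonneg_of_nonpos (by linarith) hx)
      rw [e]
      nlinarith
    · have e : b * x - s * (1 + y - a * -x - c * x) = -(s * (1 + (y + ν₂ * x))) := by
        linear_combination (-x) * hs
      have h4 : s * (1 + (y + ν₂ * x)) ≤ s * (1 + (ν₂ * w + ε)) := by gcongr
      have e' : s * (1 + (ν₂ * w + ε)) = s * (w + ε) := by linear_combination (-s) * hw
      rw [e]
      linarith
    · have e : b * x + κ₁ * (1 + y - a * -x - c * x) = κ₁ * (1 + (y + κ₁ * x)) := by
        linear_combination x * hb₁ + κ₁ * x * hpe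
      have h4 : κ₁ * (1 + C) ≤ κ₁ * (1 + (y + κ₁ * x)) := by gcongr
      rw [e]
      linarith
  · rw [abs_of_nonneg hx]
    refine ⟨?_, ?_, ?_⟩
    · have e : b * x + ν₂ * (1 + y - a * x - c * x) = ν₂ * (1 + (y + ν₂ * x)) := by
        linear_combination x * hb₂ - ν₂ * x * hqe
      have h4 : ν₂ * (1 + (y + ν₂ * x)) ≤ ν₂ * (1 + (ν₂ * w + ε)) := by gcongr
      rw [e]
      have e' : ν₂ * (1 + (ν₂ * w + ε)) = ν₂ * w + ν₂ * ε := by linear_combination (-ν₂) * hw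
      linarith
    · have e : b * x - s * (1 + y - a * x - c * x) =
          -(s * (1 + (y + ν₂ * x))) + s * ((a - c + (a + c)) * x) := by
        linear_combination (-x) * hs
      have h4 : s * (1 + (y + ν₂ * x)) ≤ s * (1 + (ν₂ * w + ε)) := by gcongr
      have e' : s * (1 + (ν₂ * w + ε)) = s * (w + ε) := by linear_combination (-s) * hw
      have h5 : 0 ≤ s * ((a - c + (a + c)) * x) :=
        mul_nonneg hs0.le (mul_nonneg (by linarith [h.p_le_q]) hx)
      rw [e]
      linarith
    · have e : b * x + κ₁ * (1 + y - a * x - c * x) = κ₁ * (1 + y - (a + c - ν₁) * x) := by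
        linear_combination x * hb₁
      obtain ⟨ρ, hρ⟩ : ∃ ρ, ρ = (2 * s + 1) / (s + ν₂) := ⟨_, rfl⟩
      rw [← hρ] at hgap
      rw [eq_div_iff (by positivity)] at hρ
      -- the lower and upper sides meet at abscissa `w + ε ρ`
      have hxw : x ≤ w + ε * ρ := by
        refine le_of_mul_le_mul_right (a := s + ν₂) ?_ (by positivity)
        have : (w + ε * ρ) * (s + ν₂) = w * (s + ν₂) + ε * (2 * s + 1) := by
          linear_combination ε * hρ
        rw [this]
        linarith
      have h4 : (a + c - ν₁ - s) * x ≤ (a + c - ν₁ - s) * (w + ε * ρ) := by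
        apply mul_le_mul_of_nonneg_left hxw
        linarith [h.lt_p, h.ν₁_lt, h.p_le_q]
      rw [e]
      refine hgap.trans_le (mul_le_mul_of_nonneg_left ?_ hκ₁.le)
      linarith

/-! ### Invariant manifolds of the right fixed point -/

/-- The line through `(r, b r)` in the direction `(μ, b)`, which is an eigenvector of the right
branch if `μ` is an eigenvalue. The parameter is `0` at `(r, b r)` and `1` on the `y`-axis. -/
noncomputable def eigenLine (b r μ t : ℝ) : Plane := !₂[r * (1 - t), b * r * (1 - t / μ)]

section eigenLine

variable {b q r μ : ℝ}

theorem eigenLine_apply_zero (t : ℝ) : eigenLine b r μ t 0 = r * (1 - t) := rfl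

theorem eigenLine_apply_one (t : ℝ) : eigenLine b r μ t 1 = b * r * (1 - t / μ) := rfl

theorem eigenLine_zero : eigenLine b r μ 0 = !₂[r, b * r] := by simp [eigenLine]

theorem continuous_eigenLine : Continuous (eigenLine b r μ) := by
  unfold eigenLine
  fun_prop

theorem eigenLine_injective (hr : r ≠ 0) : Function.Injective (eigenLine b r μ) := by
  intro t u htu
  have := congrArg (fun P : Plane => P 0) htu
  simp only [eigenLine_apply_zero] at this
  linarith [mul_left_cancel₀ hr this]

theorem tendsto_eigenLine {l : Filter ℕ} {f : ℕ → ℝ} (hf : Tendsto f l (𝓝 0)) :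
    Tendsto (fun n => eigenLine b r μ (f n)) l (𝓝 !₂[r, b * r]) := by
  rw [← eigenLine_zero (μ := μ)]
  exact continuous_eigenLine.continuousAt.tendsto.comp hf

theorem henonBranch_eigenLine (hb : b ≠ 0) (hr : r * (1 + q - b) = 1) (hμ : μ * (μ + q) = b)
    (t : ℝ) : henonBranch (-q) b hb (eigenLine b r μ t) = eigenLine b r μ (μ * t) := by
  have hμ0 : μ ≠ 0 := fun h => hb (by rw [← hμ, h, zero_mul])
  apply Plane.ext
  · rw [henonBranch_apply_zero, eigenLine_apply_zero, eigenLine_apply_one, eigenLine_apply_zero]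
    have : b * (t / μ) = (μ + q) * t := by rw [← hμ]; field_simp
    linear_combination (-1 : ℝ) * hr - r * this
  · rw [henonBranch_apply_one, eigenLine_apply_zero, eigenLine_apply_one]
    field_simp

/-- `(P 1 - b r) + μ (P 0 - r)` is an eigenfunction of the right branch. -/
theorem henonBranch_eigenfunction (hb : b ≠ 0) (hr : r * (1 + q - b) = 1) (hμ : μ * (μ + q) = b)
    (P : Plane) : henonBranch (-q) b hb P 1 - b * r + μ * (henonBranch (-q) b hb P 0 - r) =
      μ * (P 1 - b * r + μ * (P 0 - r)) := by
  rw [henonBranch_apply_zero, henonBranch_apply_one]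
  linear_combination (r - P 0) * hμ - μ * hr

theorem tendsto_eigenfunction {p : ℕ → Plane} (hp : Tendsto p atTop (𝓝 !₂[r, b * r])) :
    Tendsto (fun n => p n 1 - b * r + μ * (p n 0 - r)) atTop (𝓝 0) := by
  have hc : Continuous fun P : Plane => P 1 - b * r + μ * (P 0 - r) := by fun_prop
  have := (hc.tendsto !₂[r, b * r]).comp hp
  simpa [Function.comp_def] using this

/-- An eigenfunction with a contracted eigenvalue vanishes on the unstable manifold. -/
theorem eigenfunction_eq_zero_of_mem_unstableManifold (hb : b ≠ 0) (hr : r * (1 + q - b) = 1)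
    (hμ : μ * (μ + q) = b) (hμ1 : |μ| < 1) {P : Plane}
    (hP : P ∈ unstableManifold (henonBranch (-q) b hb) !₂[r, b * r]) :
    P 1 - b * r + μ * (P 0 - r) = 0 := by
  obtain ⟨p, rfl, hstep, hlim⟩ := hP
  have hpow : ∀ n, μ ^ n * (p n 1 - b * r + μ * (p n 0 - r)) =
      p 0 1 - b * r + μ * (p 0 0 - r) := by
    intro n
    induction n with
    | zero => simp
    | succ n ih =>
      rw [← ih, ← hstep n, henonBranch_eigenfunction hb hr hμ]
      ring
  have h1 := (tendsto_pow_atTop_nhds_zero_of_abs_lt_one hμ1).mul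
    (tendsto_eigenfunction (μ := μ) hlim)
  simp only [hpow, mul_zero] at h1
  exact tendsto_nhds_unique tendsto_const_nhds h1

/-- An eigenfunction with an expanded eigenvalue vanishes on the stable manifold. -/
theorem eigenfunction_eq_zero_of_mem_stableManifold (hb : b ≠ 0) (hr : r * (1 + q - b) = 1)
    (hμ : μ * (μ + q) = b) (hμ1 : 1 ≤ |μ|) {P : Plane}
    (hP : P ∈ stableManifold (henonBranch (-q) b hb) !₂[r, b * r]) :
    P 1 - b * r + μ * (P 0 - r) = 0 := by
  have hpow : ∀ n, (henonBranch (-q) b hb)^[n] P 1 - b * r +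
      μ * ((henonBranch (-q) b hb)^[n] P 0 - r) = μ ^ n * (P 1 - b * r + μ * (P 0 - r)) := by
    intro n
    induction n with
    | zero => simp
    | succ n ih =>
      rw [Function.iterate_succ_apply', henonBranch_eigenfunction hb hr hμ, ih]
      ring
  have h1 := (tendsto_eigenfunction (μ := μ) hP).abs
  simp only [hpow, abs_mul, abs_pow, abs_zero] at h1
  have h2 : |P 1 - b * r + μ * (P 0 - r)| ≤ 0 :=
    ge_of_tendsto' h1 fun n => le_mul_of_one_le_left (abs_nonneg _) (one_le_pow₀ hμ1)
  exact abs_eq_zero.1 (le_antisymm h2 (abs_nonneg _))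

theorem eigenLine_mem_unstableManifold (hb : b ≠ 0) (hr : r * (1 + q - b) = 1)
    (hμ : μ * (μ + q) = b) (hμ1 : 1 < |μ|) (t : ℝ) :
    eigenLine b r μ t ∈ unstableManifold (henonBranch (-q) b hb) !₂[r, b * r] := by
  have hμ0 : μ ≠ 0 := fun h => hb (by rw [← hμ, h, zero_mul])
  refine ⟨fun n => eigenLine b r μ (t * μ⁻¹ ^ n), by simp, fun n => ?_, tendsto_eigenLine ?_⟩
  · rw [henonBranch_eigenLine hb hr hμ, pow_succ]
    congr 1
    field_simp
  · rw [← mul_zero t]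
    exact (tendsto_pow_atTop_nhds_zero_of_abs_lt_one
      (by rw [abs_inv]; exact inv_lt_one_of_one_lt₀ hμ1)).const_mul t

/-- A point of `eigenLine` is determined by its abscissa. -/
theorem eq_eigenLine_one {ν κ : ℝ} (hν : ν ≠ 0) (hb : b = -(κ * ν)) {P : Plane}
    (h0 : P 0 = 0) (h1 : P 1 - b * r + κ * (P 0 - r) = 0) : P = eigenLine b r ν 1 := by
  apply Plane.ext
  · rw [h0, eigenLine_apply_zero, sub_self, mul_zero]
  · rw [eigenLine_apply_one]
    have : b * r * (1 - 1 / ν) = b * r + κ * r := by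
      rw [hb]; field_simp; ring
    rw [this]
    rw [h0] at h1
    linarith

end eigenLine

section Manifolds

variable {a b c κ ν r : ℝ}

/-- The stable line of the right branch meets the divider in one point. -/
theorem stableManifold_inter_divider (hb : b ≠ 0) (hr : r * (1 + (a + c) - b) = 1)
    (hκ : 1 < κ) (hν : 0 < ν) (hν1 : ν < 1) (hq : a + c = κ - ν) (hbe : b = κ * ν) :
    stableManifold (henonBranch (-(a + c)) b hb) !₂[r, b * r] ∩ {P | P 0 = 0} =
      {eigenLine b r ν 1} := by
  have hμ : ν * (ν + (a + c)) = b := by rw [hq, hbe]; ring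
  have hμ' : -κ * (-κ + (a + c)) = b := by rw [hq, hbe]; ring
  ext P
  constructor
  · rintro ⟨h₁, h₂⟩
    refine eq_eigenLine_one hν.ne' (by linarith) h₂
      (eigenfunction_eq_zero_of_mem_stableManifold (μ := -κ) hb hr hμ' ?_ h₁)
    rw [abs_neg, abs_of_pos (by linarith)]
    exact hκ.le
  · rintro rfl
    refine ⟨?_, by simp [eigenLine_apply_zero]⟩
    have hit : ∀ n : ℕ, (henonBranch (-(a + c)) b hb)^[n] (eigenLine b r ν 1) =
        eigenLine b r ν (ν ^ n) := by
      intro n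
      induction n with
      | zero => simp
      | succ n ih =>
        rw [Function.iterate_succ_apply', ih, henonBranch_eigenLine hb hr hμ, pow_succ']
    simp only [stableManifold, mem_ofPred_eq, hit]
    exact tendsto_eigenLine (tendsto_pow_atTop_nhds_zero_of_lt_one hν.le hν1)

/-- The unstable line of the right branch meets the divider in one point. -/
theorem unstableManifold_inter_divider (hb : b ≠ 0) (hr : r * (1 + (a + c) - b) = 1)
    (hκ : 1 < κ) (hν : 0 < ν) (hν1 : ν < 1) (hq : a + c = κ - ν) (hbe : b = κ * ν) :
    unstableManifold (henonBranch (-(a + c)) b hb) !₂[r, b * r] ∩ {P | P 0 = 0} =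
      {eigenLine b r (-κ) 1} := by
  have hμ : ν * (ν + (a + c)) = b := by rw [hq, hbe]; ring
  have hμ' : -κ * (-κ + (a + c)) = b := by rw [hq, hbe]; ring
  ext P
  constructor
  · rintro ⟨h₁, h₂⟩
    refine eq_eigenLine_one (neg_ne_zero.2 (by linarith)) (by linarith) h₂
      (eigenfunction_eq_zero_of_mem_unstableManifold (μ := ν) hb hr hμ ?_ h₁)
    rwa [abs_of_pos hν]
  · rintro rfl
    refine ⟨eigenLine_mem_unstableManifold hb hr hμ' ?_ 1, by simp [eigenLine_apply_zero]⟩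
    rwa [abs_neg, abs_of_pos (by linarith)]

theorem loziFamily_eigenLine_of_le_one {μ t : ℝ} (hb : b ≠ 0) (hr : r * (1 + (a + c) - b) = 1)
    (hr0 : 0 < r) (hμ : μ * (μ + (a + c)) = b) (ht : t ≤ 1) :
    loziFamily a b c (eigenLine b r μ t) = eigenLine b r μ (μ * t) := by
  rw [loziFamily_eq_right a c hb (by rw [eigenLine_apply_zero]; nlinarith),
    henonBranch_eigenLine hb hr hμ]

theorem loziFamily_eigenLine_of_one_le {μ t : ℝ} (hb : b ≠ 0) (hr0 : 0 < r) (ht : 1 ≤ t) :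
    loziFamily a b c (eigenLine b r μ t) = henonBranch (a - c) b hb (eigenLine b r μ t) :=
  loziFamily_eq_left a c hb (by rw [eigenLine_apply_zero]; nlinarith)

/-- The segment of the stable line between the fixed point and the divider stays in the right
half-plane. -/
theorem eigenLine_mem_stableManifold_loziFamily {t : ℝ} (hb : b ≠ 0)
    (hr : r * (1 + (a + c) - b) = 1) (hr0 : 0 < r) (hν : 0 < ν) (hν1 : ν < 1)
    (hμ : ν * (ν + (a + c)) = b) (ht0 : 0 ≤ t) (ht1 : t ≤ 1) :
    eigenLine b r ν t ∈ stableManifold (loziFamily a b c) !₂[r, b * r] := by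
  have hit : ∀ n : ℕ, (loziFamily a b c)^[n] (eigenLine b r ν t) = eigenLine b r ν (ν ^ n * t) := by
    intro n
    induction n with
    | zero => simp
    | succ n ih =>
      rw [Function.iterate_succ_apply', ih, loziFamily_eigenLine_of_le_one hb hr hr0 hμ,
        pow_succ', mul_assoc]
      exact mul_le_one₀ (pow_le_one₀ hν.le hν1.le) ht0 ht1
  simp only [stableManifold, mem_ofPred_eq, hit]
  apply tendsto_eigenLine
  rw [← zero_mul t]
  exact (tendsto_pow_atTop_nhds_zero_of_lt_one hν.le hν1).mul_const t

/-- The points with parameters in `[1, κ²]` on the unstable line lie on the left of the divider,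
but all of their preimages lie on the right; so their images under the left branch belong to the
unstable manifold of the glued map. -/
theorem henonBranch_eigenLine_mem_unstableManifold_loziFamily {t : ℝ} (hb : b ≠ 0)
    (hr : r * (1 + (a + c) - b) = 1) (hr0 : 0 < r) (hκ : 1 < κ)
    (hμ : -κ * (-κ + (a + c)) = b) (ht0 : 1 ≤ t) (ht1 : t ≤ κ ^ 2) :
    henonBranch (a - c) b hb (eigenLine b r (-κ) t) ∈
      unstableManifold (loziFamily a b c) !₂[r, b * r] := by
  have hκ0 : -κ ≠ 0 := neg_ne_zero.2 (by linarith)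
  have hinv : |(-κ)⁻¹| < 1 := by
    rw [abs_inv, abs_neg, abs_of_pos (by linarith)]
    exact inv_lt_one_of_one_lt₀ hκ
  have hle : ∀ n : ℕ, t * (-κ)⁻¹ ^ (n + 1) ≤ 1 := by
    intro n
    rcases n with _ | n
    · have : (-κ)⁻¹ < 0 := inv_lt_zero.2 (by linarith)
      rw [zero_add, pow_one]
      nlinarith
    · have h1 : t * (-κ)⁻¹ ^ (n + 1 + 1) = t / κ ^ 2 * (-κ)⁻¹ ^ n := by
        have e : (-κ)⁻¹ ^ 2 = (κ ^ 2)⁻¹ := by rw [inv_pow, neg_sq]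
        rw [add_assoc, one_add_one_eq_two, pow_add, e]
        ring
      have h2 : t / κ ^ 2 ≤ 1 := div_le_one_of_le₀ ht1 (sq_nonneg κ)
      have h3 : (-κ)⁻¹ ^ n ≤ 1 := by
        refine (le_abs_self _).trans ?_
        rw [abs_pow]
        exact pow_le_one₀ (abs_nonneg _) hinv.le
      have h4 : 0 ≤ t / κ ^ 2 := by positivity
      rw [h1]
      nlinarith
  -- from the second term on, the backward orbit follows the right branch along the unstable line
  refine ⟨fun n => Nat.casesOn n (henonBranch (a - c) b hb (eigenLine b r (-κ) t))
    fun n => eigenLine b r (-κ) (t * (-κ)⁻¹ ^ n), rfl, fun n => ?_, ?_⟩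
  · rcases n with _ | n
    · simp only [pow_zero, mul_one]
      exact loziFamily_eigenLine_of_one_le hb hr0 ht0
    · refine (loziFamily_eigenLine_of_le_one hb hr hr0 hμ (hle n)).trans ?_
      simp only [pow_succ]
      congr 1
      field_simp
  · rw [← tendsto_add_atTop_iff_nat 1]
    refine tendsto_eigenLine ?_
    rw [← mul_zero t]
    exact (tendsto_pow_atTop_nhds_zero_of_abs_lt_one hinv).const_mul t

end Manifolds

theorem henonBranch_injective (s b : ℝ) (hb : b ≠ 0) :
    Function.Injective (henonBranch s b hb) :=
  (henonBranch s b hb).injective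

/-- The image of an affinely parametrized interval under a continuous injective curve is an
arc. -/
theorem isArc_of_injective {γ : ℝ → Plane} (hc : Continuous γ) (hi : Function.Injective γ)
    {u v : ℝ} (huv : u ≠ v) {P Q : Plane} (hP : γ u = P) (hQ : γ v = Q) :
    IsArc P Q (γ '' segment ℝ u v) := by
  refine ⟨⟨⟨fun t => γ (AffineMap.lineMap u v (t : ℝ)), ?_⟩, by simpa using hP, by simpa using hQ⟩,
    ?_, ?_⟩
  · exact hc.comp (AffineMap.lineMap_continuous.comp continuous_subtype_val)
  · intro s t hst
    exact Subtype.ext (AffineMap.lineMap_injective ℝ huv (hi hst))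
  · rw [segment_eq_image_lineMap, image_image,
      ← Subtype.range_coe (s := Icc (0 : ℝ) 1), ← range_comp]
    rfl

/-- The only fixed point of the map in the triangle is that of the right branch: the fixed point
of the left branch lies to the left of the left side. -/
theorem loziFamily_fixedPoints {a b c κ₁ ν₁ κ₂ ν₂ r C : ℝ}
    (h : LoziSpectrum b (a - c) (a + c) κ₁ ν₁ κ₂ ν₂) (hr : r * (1 + (a + c) - b) = 1)
    (hC : -κ₁ < C * (κ₁ - 1)) {P : Plane} (hP : C < P 1 + κ₁ * P 0)
    (hfix : loziFamily a b c P = P) : P = !₂[r, b * r] := by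
  have h0 : 1 + P 1 - a * |P 0| - c * P 0 = P 0 := congrArg (fun Q : Plane => Q 0) hfix
  have h1 : b * P 0 = P 1 := congrArg (fun Q : Plane => Q 1) hfix
  rcases le_or_gt 0 (P 0) with hx | hx
  · rw [abs_of_nonneg hx] at h0
    have hx' : P 0 = r := by linear_combination (-P 0) * hr - r * h0 - r * h1
    refine Plane.ext hx' ?_
    rw [← h1, hx']
    rfl
  · exfalso
    rw [abs_of_neg hx] at h0
    -- the value of `y + κ₁ x` at the fixed point of the left branch is `-κ₁ / (κ₁ - 1)`
    have hκ := h.one_lt_κ₁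
    have h2 : (P 1 + κ₁ * P 0) * (κ₁ - 1) = -κ₁ := by
      have hp := h.p_eq
      have hb := h.b_eq₁
      rw [← h1] at h0 ⊢
      linear_combination κ₁ * h0 - κ₁ * P 0 * hp - P 0 * hb
    nlinarith [mul_lt_mul_of_pos_right hP (show 0 < κ₁ - 1 by linarith)]

/-! ### The Lozi-like structure and the arcs -/

/-- The Lozi-like structure on `F_{a,b,c}` with a given stretching factor and triangle. -/
noncomputable def loziFamilyLoziLike {a b c κ₁ ν₁ κ₂ ν₂ L w s ε C : ℝ}
    (h : LoziSpectrum b (a - c) (a + c) κ₁ ν₁ κ₂ ν₂) (hL : 1 < L)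
    (h₁ : L ^ 2 * (1 + (b * √2 / 2) ^ 2) ≤ (a - c - b * √2 / 2) ^ 2 + b ^ 2)
    (h₂ : L ^ 2 * (1 + (√2 / 2) ^ 2) * b ^ 2 ≤ (a - c - b * √2 / 2) ^ 2 + 1)
    (hs : 0 < s)
    (hne : (openTriangle ν₂ s κ₁ (ν₂ * w + ε) (s * (w + 2 * ε)) C).Nonempty)
    (htrap : ∀ P ∈ closedTriangle ν₂ s κ₁ (ν₂ * w + ε) (s * (w + 2 * ε)) C,
      loziFamily a b c P ∈ openTriangle ν₂ s κ₁ (ν₂ * w + ε) (s * (w + 2 * ε)) C) :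
    LoziLike (loziFamily a b c) :=
  have hdisk := Convex.nonempty_homeomorph_ball (convex_openTriangle _ _ _ _ _ _)
    (isOpen_openTriangle _ _ _ _ _ _) hne (isBounded_openTriangle _ _ _
      (add_pos h.ν₂_pos hs) (h.ν₂_lt_one.trans h.one_lt_κ₁))
  have hdet : ∀ (t : ℝ) (P : Plane),
      (fderiv ℝ (henonBranch t b h.b_pos.ne') P).det ∈ Ioo (-1 : ℝ) 0 := fun t P => by
    rw [det_fderiv_henonBranch]
    exact ⟨by linarith [h.b_lt_one], by linarith [h.b_pos]⟩
  { F₁ := henonBranch (a - c) b h.b_pos.ne'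
    F₂ := henonBranch (-(a + c)) b h.b_pos.ne'
    sync := loziSynchronouslyHyperbolic h.b_pos h.b_lt_one h.lt_p h.p_le_q hL h₁ h₂
    eq_left := fun _ hP => loziFamily_eq_left a c _ hP
    eq_right := fun _ hP => loziFamily_eq_right a c _ hP
    det₁ := hdet _
    det₂ := hdet _
    Δ := openTriangle ν₂ s κ₁ (ν₂ * w + ε) (s * (w + 2 * ε)) C
    trapping := ⟨hne, by
      rw [(isOpen_openTriangle _ _ _ _ _ _).interior_eq]
      rintro _ ⟨P, hP, rfl⟩
      exact htrap P (closure_openTriangle_subset _ _ _ _ _ _ hP)⟩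
    open_disk := hdisk.1
    closed_disk := hdisk.2 }

/-- The arc of the unstable manifold from `F³(D)` to `F(D)` and the arc of the stable manifold
from `X` to `M`, both of them segments, have a point in common. -/
theorem exists_intersecting_arcs {a b c κ₁ ν₁ κ₂ ν₂ r : ℝ}
    (h : LoziSpectrum b (a - c) (a + c) κ₁ ν₁ κ₂ ν₂) (hr : r * (1 + (a + c) - b) = 1)
    (hr0 : 0 < r) {F : Plane → Plane} (hF : F = loziFamily a b c) {D : Plane}
    (hD : D = eigenLine b r (-κ₂) 1) :
    ∃ A B : Set Plane,
      IsArc (F (F (F D))) (F D) A ∧ A ⊆ unstableManifold F !₂[r, b * r] ∧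
      IsArc !₂[r, b * r] (eigenLine b r ν₂ 1) B ∧ B ⊆ stableManifold F !₂[r, b * r] ∧
      (A ∩ B).Nonempty := by
  subst hF hD
  have hb := h.b_pos.ne'
  have hκ : 1 < κ₂ := h.one_lt_κ₁.trans_le h.κ₁_le_κ₂
  have hκ2 : 1 < κ₂ ^ 2 := one_lt_pow₀ hκ two_ne_zero
  have hq := h.q_eq
  have hbe := h.b_eq₂
  have hν := h.ν₂_pos
  have hμ : ν₂ * (ν₂ + (a + c)) = b := by rw [hq, hbe]; ring
  have hμ' : -κ₂ * (-κ₂ + (a + c)) = b := by rw [hq, hbe]; ring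
  -- `D`, `F(D)`, `F²(D)` have parameters `1`, `-κ₂`, `κ₂²` on the unstable line
  have hFD : loziFamily a b c (eigenLine b r (-κ₂) 1) = eigenLine b r (-κ₂) (-κ₂) := by
    rw [loziFamily_eigenLine_of_le_one hb hr hr0 hμ' le_rfl, mul_one]
  have hFFD : loziFamily a b c (eigenLine b r (-κ₂) (-κ₂)) = eigenLine b r (-κ₂) (κ₂ ^ 2) := by
    rw [loziFamily_eigenLine_of_le_one hb hr hr0 hμ' (by linarith)]
    congr 1
    ring
  refine ⟨(fun t => henonBranch (a - c) b hb (eigenLine b r (-κ₂) t)) '' segment ℝ (κ₂ ^ 2) 1,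
    eigenLine b r ν₂ '' segment ℝ 0 1, ?_, ?_, ?_, ?_, ?_⟩
  · apply isArc_of_injective
    · exact (henonBranch (a - c) b hb).continuous.comp continuous_eigenLine
    · exact (henonBranch_injective _ _ _).comp (eigenLine_injective hr0.ne')
    · exact hκ2.ne'
    · rw [hFD, hFFD, loziFamily_eigenLine_of_one_le hb hr0 hκ2.le]
    · exact (loziFamily_eigenLine_of_one_le hb hr0 le_rfl).symm
  · rintro _ ⟨t, ht, rfl⟩
    rw [segment_symm, segment_eq_Icc hκ2.le] at ht
    exact henonBranch_eigenLine_mem_unstableManifold_loziFamily hb hr hr0 hκ hμ' ht.1 ht.2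
  · exact isArc_of_injective continuous_eigenLine (eigenLine_injective hr0.ne') zero_ne_one
      eigenLine_zero rfl
  · rintro _ ⟨t, ht, rfl⟩
    rw [segment_eq_Icc zero_le_one] at ht
    exact eigenLine_mem_stableManifold_loziFamily hb hr hr0 hν h.ν₂_lt_one hμ ht.1 ht.2
  · have hp : 0 < a - c - 2 * ν₂ := by
      have hs : 1 < √2 := Real.lt_sqrt_of_sq_lt (by norm_num)
      have hs' : √2 < 1.5 := by rw [Real.sqrt_lt' (by norm_num)]; norm_num
      have := h.b_lt
      have := h.b_pos
      have := h.ν₂_le_ν₁.trans_lt h.ν₁_lt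
      nlinarith [h.lt_p]
    -- the line through `F(D)` and `F³(D)` meets the stable line at parameter `t`
    obtain ⟨t, ht⟩ : ∃ t, t * (a - c - 2 * ν₂) = a - c + (a + c) :=
      ⟨_, div_mul_cancel₀ _ hp.ne'⟩
    have ht1 : 1 ≤ t := by
      refine le_of_mul_le_mul_right ?_ hp
      rw [ht]
      linarith [h.κ₂_pos]
    have htκ : t ≤ κ₂ ^ 2 := by
      refine le_of_mul_le_mul_right ?_ hp
      rw [ht]
      have := h.lt_p_mul
      rw [hq]
      nlinarith
    have htν : ν₂ * t ≤ 1 := by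
      refine le_of_mul_le_mul_right ?_ hp
      rw [mul_assoc, ht, hq]
      have := h.lt_p_sub_mul
      nlinarith
    refine ⟨eigenLine b r ν₂ (ν₂ * t), ⟨t, ?_, ?_⟩, ⟨ν₂ * t, ?_, rfl⟩⟩
    · rw [segment_symm, segment_eq_Icc hκ2.le]
      exact ⟨ht1, htκ⟩
    · have hκ0 := h.κ₂_pos.ne'
      apply Plane.ext
      · simp only [henonBranch_apply_zero, eigenLine_apply_zero, eigenLine_apply_one]
        have e : b * (t / -κ₂) = -(ν₂ * t) := by rw [hbe]; field_simp
        linear_combination (-1 : ℝ) * hr - r * e - r * ht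
      · simp only [henonBranch_apply_one, eigenLine_apply_zero, eigenLine_apply_one]
        field_simp
    · rw [segment_eq_Icc zero_le_one]
      exact ⟨by positivity, htν⟩

theorem mainTheorem3 (a b c : ℝ)
    (hA1b : 0 < b ∧ b < 1) (hA1c : 0 ≤ c)
    (hA2 : (2 * a + b) * (1 - c ^ 2 / (a + b) ^ 2) < 4)
    (hA3 : (a - c) * √2 > b + 2) :
    ∃ S : LoziLike (loziFamily a b c),
      (∀ P : Plane, S.F₁ P = !₂[1 + P 1 + (a - c) * P 0, b * P 0]) ∧
      (∀ P : Plane, S.F₂ P = !₂[1 + P 1 - (a + c) * P 0, b * P 0]) ∧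
      S.sync.Γ = {P : Plane | P 0 = 0} ∧
      S.L3 ∧ S.L4 := by
  obtain ⟨κ₁, ν₁, κ₂, ν₂, h⟩ := exists_loziSpectrum hA1b.1 hA1b.2 hA1c hA2 hA3
  have hb := h.b_pos
  have hν := h.ν₂_pos
  have hκ₂ : 1 < κ₂ := h.one_lt_κ₁.trans_le h.κ₁_le_κ₂
  have hν₂' : ν₂ < b * √2 / 2 := h.ν₂_le_ν₁.trans_lt h.ν₁_lt
  have h20 : 0 < √2 := by positivity
  obtain ⟨L, hL, hL₁, hL₂⟩ := exists_stretch_gt_sqrt_two (t := a - c - b * √2 / 2) hb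
    h.b_lt_one (by linarith [h.lt_p])
  have hL1 : 1 < L := lt_of_le_of_lt (by rw [Real.one_le_sqrt]; norm_num) hL
  -- `w` is the abscissa of `F(D)`, `s` the slope of the segment from `F(D)` to `F³(D)`, and
  -- `r` the abscissa of `X`
  obtain ⟨w, hw⟩ : ∃ w, w * (1 - ν₂) = 1 := ⟨_, inv_mul_cancel₀ (by linarith [h.ν₂_lt_one])⟩
  have hw0 : 0 < w := pos_of_mul_pos_left (hw ▸ one_pos) (by linarith [h.ν₂_lt_one])
  obtain ⟨s, hs⟩ : ∃ s, s * (a - c - ν₂) = b :=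
    ⟨_, div_mul_cancel₀ _ (by linarith [h.lt_p])⟩
  have hs0 : 0 < s := pos_of_mul_pos_left (hs ▸ hb) (by linarith [h.lt_p])
  obtain ⟨r, hrw⟩ : ∃ r, r * (1 + κ₂) = w := ⟨_, div_mul_cancel₀ _ (by linarith)⟩
  have hr0 : 0 < r := pos_of_mul_pos_left (hrw ▸ hw0) (by linarith)
  have hr : r * (1 + (a + c) - b) = 1 := by
    rw [← hrw] at hw
    linear_combination hw + r * h.q_eq - r * h.b_eq₂
  obtain ⟨ε, C, hε, hC0, hC, hCκ, hgap⟩ := h.exists_offsets hw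
    (2 * s + (a + c - ν₁ - s) * ((2 * s + 1) / (s + ν₂)))
  have hX : !₂[r, b * r] ∈ openTriangle ν₂ s κ₁ (ν₂ * w + ε) (s * (w + 2 * ε)) C := by
    refine ⟨?_, ?_, ?_⟩ <;> simp
    · have : b * r + ν₂ * r = ν₂ * w := by rw [← hrw, h.b_eq₂]; ring
      linarith
    · have : r < w := by nlinarith
      nlinarith [mul_pos hb hr0, mul_pos hs0 hε, mul_pos hs0 (sub_pos.2 this)]
    · have := h.κ₁_pos
      have : 0 < b * r + κ₁ * r := by positivity
      linarith
  have hfix : loziFamily a b c !₂[r, b * r] = !₂[r, b * r] := by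
    have hμ : ν₂ * (ν₂ + (a + c)) = b := by rw [h.q_eq, h.b_eq₂]; ring
    have := loziFamily_eigenLine_of_le_one hb.ne' hr hr0 hμ zero_le_one
    rwa [mul_zero, eigenLine_zero] at this
  have hΓ : {P : Plane | P 0 = (fun _ : ℝ => (0 : ℝ)) (P 1)} = {P : Plane | P 0 = 0} := rfl
  refine ⟨loziFamilyLoziLike h hL1 hL₁ hL₂ hs0 ⟨_, hX⟩
    fun P hP => loziFamily_mem_openTriangle h hw hs hε hC hgap hP, ?_, ?_, hΓ, ?_, hL⟩
  · intro P
    exact Plane.ext (henonBranch_apply_zero _ _ hb.ne' _) (henonBranch_apply_one _ _ hb.ne' _)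
  · intro P
    refine Plane.ext ((henonBranch_apply_zero _ _ hb.ne' _).trans ?_)
      (henonBranch_apply_one _ _ hb.ne' _)
    simp
    ring
  · refine ⟨!₂[r, b * r], eigenLine b r (-κ₂) 1, eigenLine b r ν₂ 1, ?_, ?_, ?_, ?_,
      exists_intersecting_arcs h hr hr0 rfl rfl⟩
    · ext P
      constructor
      · rintro ⟨hP, hPfix⟩
        exact loziFamily_fixedPoints h hr hCκ hP.2.2 hPfix
      · rintro rfl
        exact ⟨hX, hfix⟩
    · exact hr0.le
    · exact unstableManifold_inter_divider hb.ne' hr hκ₂ hν h.ν₂_lt_one h.q_eq h.b_eq₂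
    · exact stableManifold_inter_divider hb.ne' hr hκ₂ hν h.ν₂_lt_one h.q_eq h.b_eq₂
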